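/- Let $p$ be a prime, $s\ge 1$ an integer, and let $K=\mathbb{Q}(\theta)$, where $\theta$ is a root of an irreducible polynomial $x^{p^s}-a\in\mathbb{Z}[x]$. Assume that $|a|$ is $p^s$-th power free and write $|a|=\prod_{j=1}^{p^s-1}a_j^{\,j}$ with $a_1,\dots,a_{p^s-1}$ squarefree positive integers that are relatively prime in pairs. Let $v_p$ denote the $p$-adic valuation and $\varphi$ Euler's function, and assume that $p$ does not divide $\gcd(a,v_p(a))$. Put $$r=v_p(a^{p-1}-1)-1,\qquad d=\min\{r,s\},\qquad C_m=\prod_{j=1}^{p^s-1}a_j^{\lfloor jm/p^s\rfloor}\quad(0\le m<p^s).$$ An integral basis of $K$ means a $\mathbb{Z}$-basis of the ring of algebraic integers of $K$. Then the following hold. (i) If $r=0$ or $r=-1$, then $\left\{\dfrac{\theta^m}{C_m} : 0\le m<p^s\right\}$ is an integral basis of $K$. (ii) Suppose $r\ge 1$. For $0\le m<p^s$ let $k_m$ be the largest non-negative integer not exceeding $d$ such that $m\ge p^s-p^{s-k_m}$, and define $j_m\ge 0$ by $m=p^s-p^{s-k_m}+j_m$. For each $m$ with $\varphi(p^s)\le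 m<p^s$ let $a'_m$ be any integer with $$a'_m\equiv\begin{cases}a^{(p-2)p^{s-k_m-1}} \pmod{p^{k_m+1}} & \text{if } k_m<s,\\ a^{p-2}\pmod{p^{k_m+1}} & \text{if } k_m=s,\end{cases}$$ let $w_m$ be any integer with $w_mC_m(a'_m)^{p^{k_m}-1}\equiv 1\pmod{p^{k_m}}$, and put $$\delta_m=w_mC_m\theta^{j_m}\sum_{i=0}^{p^{k_m}-2}\left(a'_m\theta^{p^{s-k_m}}\right)^i .$$ Then $$\left\{\frac{\theta^m}{C_m} : 0\le m<\varphi(p^s)\right\}\cup\left\{\frac{\theta^m+\delta_m}{p^{k_m}C_m} : \varphi(p^s)\le m<p^s\right\}$$ is an integral basis of $K$. -/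

import Mathlib

open Polynomial NumberField

namespace PureField

/-- The finite family `b` of elements of `K` is an integral basis of `K`: its members are algebraic
integers and form a basis of the `ℤ`-module `𝓞 K`. -/
def IsIntegralBasis {K : Type*} [Field K] [NumberField K] {ι : Type*} (b : ι → K) : Prop :=
  ∃ B : Module.Basis ι ℤ (𝓞 K), ∀ i, (B i : K) = b i

/-- `C_m = ∏_{j = 1}^{n - 1} a_j ^ ⌊j m / n⌋`; here `c j` is `a_j`, and `/` is division of natural
numbers with rounding down. -/
def C (n : ℕ) (c : ℕ → ℕ) (m : ℕ) : ℕ :=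
  ∏ j ∈ Finset.Icc 1 (n - 1), c j ^ (j * m / n)

/-- The integer `r = v_p(a ^ (p - 1) - 1) - 1`. It can be negative. -/
def r (p : ℕ) (a : ℤ) : ℤ :=
  (padicValInt p (a ^ (p - 1) - 1) : ℤ) - 1

/-- The integer `d = min {r, s}`. -/
def d (p s : ℕ) (a : ℤ) : ℤ :=
  min (r p a) s

/-- For `d ≥ 0`, the largest natural number `k ≤ d` with `m ≥ p ^ s - p ^ (s - k)`
(`k = 0` always qualifies). It is used only for `r ≥ 1`. -/
def k (p s : ℕ) (a : ℤ) (m : ℕ) : ℕ :=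
  Nat.findGreatest (fun i => p ^ s - p ^ (s - i) ≤ m) (d p s a).toNat

/-- The natural number `j_m` with `m = p ^ s - p ^ (s - k_m) + j_m`. -/
def j (p s : ℕ) (a : ℤ) (m : ℕ) : ℕ :=
  m - (p ^ s - p ^ (s - k p s a m))

/-- `δ_m = w C_m θ ^ j_m ∑_{i = 0}^{p ^ k_m - 2} (a' θ ^ (p ^ (s - k_m))) ^ i`, for the chosen
integers `a' = a'_m` and `w = w_m`. -/
def delta {K : Type*} [Field K] (p s : ℕ) (a : ℤ) (c : ℕ → ℕ) (θ : K) (a' w : ℤ) (m : ℕ) : K :=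
  (w : K) * (C (p ^ s) c m : K) * θ ^ j p s a m *
    ∑ i ∈ Finset.range (p ^ k p s a m - 1), ((a' : K) * θ ^ p ^ (s - k p s a m)) ^ i

end PureField

namespace PureField

/-! ### Minimal polynomial, embeddings and a norm. -/

section Setup

variable {K : Type*} [Field K] [NumberField K]

/-! Write n = p^s and let b_m be the coefficient of an algebraic integer β at θ^m. A family of
integers triangular in the powers of θ, with leading coefficients 1/N_m, is an integral basis as
soon as every integer of θ-degree at most m has b_m in (1/N_m)ℤ (`isIntegralBasis_of_triangular`).
So the task is to bound leading denominators. Weighting the conjugates of β by roots of unity shows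
that n b_m θ^m is integral, whence n C_m b_m ∈ ℤ, and only the power of p remains to be settled.

Let r ≥ 0, so p ∤ a. Put y = a^(p-2) θ and A = y^n; then v_p(A - 1) = r + 1. The averages D_k =
`geomAvg p s y k`, k ≤ d, are integral (`isIntegral_geom_sum_div`). The element y - 1 is nilpotent
mod p and its norm ±(A - 1) has exactly r + 1 factors p, so 𝓞/(y - 1, p^(r+1)) has at most p^(r+1)
elements. Partial traces show that the D_k are independent modulo the radical of (p), so their
integer combinations already fill this quotient (`exists_sum_sub_mem`). A Nakayama-type iteration
gives 𝓞 = V + n𝓞, where V is the ℤ[y]-module generated by the D_k. V has a ℤ-basis triangular in y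
with leading coefficients p^(-k_m), and A n 𝓞 ⊆ ℤ[y] ⊆ V. Since A is prime to p, combining this with
n C_m b_m ∈ ℤ leaves the denominator p^(k_m) C_m, which the elements of (ii) attain.

If r = -1 then p ∣ a, and p ∤ v_p(a) yields a monomial π in θ with π^n equal to p times a p-unit.
The same count, with D_0 = 1 alone, gives 𝓞 = ℤ[π] + n𝓞; powers of π are monomials in θ, so no extra
p occurs. -/

theorem minpoly_eq {n : ℕ} (hn : n ≠ 0) {a : ℤ} (hirr : Irreducible (X ^ n - Polynomial.C a : ℤ[X]))
    {θ : K} (hθ : θ ^ n = (a : K)) : minpoly ℚ θ = X ^ n - Polynomial.C (a : ℚ) := by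
  have hm : (X ^ n - Polynomial.C a : ℤ[X]).Monic := monic_X_pow_sub_C _ hn
  have h1 := (hm.irreducible_iff_irreducible_map_fraction_map (K := ℚ)).1 hirr
  have h2 : (X ^ n - Polynomial.C a : ℤ[X]).map (algebraMap ℤ ℚ) =
      X ^ n - Polynomial.C (a : ℚ) := by simp
  rw [h2] at h1
  refine (minpoly.eq_of_irreducible_of_monic h1 ?_ (monic_X_pow_sub_C _ hn)).symm
  simp [hθ]

/-- The powers `θ ^ i`, `i < n`, form the `ℚ`-basis `B` of `K`, and `σ l` is the embedding of `K`
into `ℂ` that sends `θ` to `ζ ^ l * σ 0 θ`. -/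
structure IsRadicalGenerator (n : ℕ) (θ : K) (B : Module.Basis (Fin n) ℚ K) (ζ : ℂ)
    (σ : ℕ → K →+* ℂ) : Prop where
  basis_apply : ∀ i, B i = θ ^ (i : ℕ)
  isPrimitiveRoot : IsPrimitiveRoot ζ n
  map_gen : ∀ l, σ l θ = ζ ^ l * σ 0 θ

theorem exists_isRadicalGenerator {n : ℕ} (hn : n ≠ 0) {a : ℤ}
    (hirr : Irreducible (X ^ n - Polynomial.C a : ℤ[X]))
    {θ : K} (hθ : θ ^ n = (a : K)) (hK : IntermediateField.adjoin ℚ {θ} = ⊤) :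
    ∃ B ζ σ, IsRadicalGenerator n θ B ζ σ := by
  have hInt : IsIntegral ℚ θ := Algebra.IsIntegral.isIntegral θ
  have hmin := minpoly_eq hn hirr hθ
  have htop : Algebra.adjoin ℚ {θ} = ⊤ := by
    rw [← IntermediateField.adjoin_simple_toSubalgebra_of_isAlgebraic hInt.isAlgebraic, hK]; rfl
  let pb := PowerBasis.ofAdjoinEqTop hInt htop
  have hgen : pb.gen = θ := PowerBasis.ofAdjoinEqTop_gen hInt htop
  have hdim : pb.dim = n := by
    rw [show pb.dim = (minpoly ℚ θ).natDegree from PowerBasis.ofAdjoinEqTop_dim hInt htop, hmin]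
    exact natDegree_X_pow_sub_C
  obtain ⟨ι⟩ : Nonempty (K →+* ℂ) := inferInstance
  let ζ := Complex.exp (2 * Real.pi * Complex.I / n)
  have hζ : IsPrimitiveRoot ζ n := Complex.isPrimitiveRoot_exp n hn
  have hl : ∀ l : ℕ, aeval (ζ ^ l * ι θ) (minpoly ℚ pb.gen) = 0 := by
    intro l
    rw [hgen, hmin]
    simp only [map_sub, map_pow, aeval_X, aeval_C]
    rw [mul_pow, ← pow_mul, mul_comm l n, pow_mul, hζ.pow_eq_one, one_pow, one_mul, ← map_pow, hθ]
    simp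
  refine ⟨pb.basis.reindex (finCongr hdim), ζ, fun l => (pb.lift _ (hl l)).toRingHom, ?_, hζ, ?_⟩
  · intro i
    simp [hgen]
  · intro l
    have h : ∀ l, (pb.lift _ (hl l)).toRingHom θ = ζ ^ l * ι θ := fun l => by
      have := pb.lift_gen _ (hl l)
      rw [hgen] at this
      exact this
    simp only [h]; simp

/-- The minimal polynomial of θ - c⁻¹ is (X + c⁻¹)^n - a, and the norm is read off from its constant
term. -/
theorem norm_mul_sub_one {n : ℕ} (hn : n ≠ 0) {a : ℤ}
    (hirr : Irreducible (X ^ n - Polynomial.C a : ℤ[X]))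
    {θ : K} (hθ : θ ^ n = (a : K)) (hK : IntermediateField.adjoin ℚ {θ} = ⊤) {c : ℚ} (hc : c ≠ 0) :
    |Algebra.norm ℚ ((c : K) * θ - 1)| = |c ^ n * a - 1| := by
  have hmin := minpoly_eq hn hirr hθ
  have hInt : IsIntegral ℚ θ := Algebra.IsIntegral.isIntegral θ
  have htop : Algebra.adjoin ℚ {θ} = ⊤ := by
    rw [← IntermediateField.adjoin_simple_toSubalgebra_of_isAlgebraic hInt.isAlgebraic, hK]; rfl
  have hmin' := minpoly.sub_algebraMap (A := ℚ) θ c⁻¹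
  have hInt' : IsIntegral ℚ (θ - algebraMap ℚ K c⁻¹) := Algebra.IsIntegral.isIntegral _
  have htop' : Algebra.adjoin ℚ {θ - algebraMap ℚ K c⁻¹} = ⊤ := by
    rw [eq_top_iff, ← htop]
    refine Algebra.adjoin_le (Set.singleton_subset_iff.2 ?_)
    have h1 := Algebra.subset_adjoin (R := ℚ) (Set.mem_singleton (θ - algebraMap ℚ K c⁻¹))
    have h2 := add_mem h1 (Subalgebra.algebraMap_mem _ c⁻¹)
    simpa using h2
  let pb := PowerBasis.ofAdjoinEqTop hInt' htop'
  have hgen : pb.gen = θ - algebraMap ℚ K c⁻¹ := PowerBasis.ofAdjoinEqTop_gen hInt' htop'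
  have hnorm := Algebra.PowerBasis.norm_gen_eq_coeff_zero_minpoly pb
  have hfr : Module.finrank ℚ K = n := by
    obtain ⟨B, -⟩ := exists_isRadicalGenerator hn hirr hθ hK
    rw [Module.finrank_eq_card_basis B, Fintype.card_fin]
  rw [hgen, hmin', hmin] at hnorm
  have hfac : (c : K) * θ - 1 = algebraMap ℚ K c * (θ - algebraMap ℚ K c⁻¹) := by
    rw [mul_sub, ← map_mul, mul_inv_cancel₀ hc]; simp
  rw [hfac, map_mul, hnorm, Algebra.norm_algebraMap, hfr, coeff_zero_eq_eval_zero]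
  simp only [eval_comp, eval_sub, eval_pow, eval_X, eval_C, eval_add, abs_mul, abs_pow, abs_neg,
    abs_one, one_pow, one_mul, zero_add]
  rw [← abs_pow, ← abs_mul, mul_sub, ← mul_pow, mul_inv_cancel₀ hc, one_pow, abs_sub_comm]

end Setup

/-! ### Sums over conjugates: denominators and independence modulo p. -/

section Conjugates

variable {K : Type*} [Field K] [NumberField K]

theorem sum_range_pow_of_pow_eq_one {F : Type*} [Field F] {ω : F} {N : ℕ} (h : ω ^ N = 1)
    (h1 : ω ≠ 1) : ∑ l ∈ Finset.range N, ω ^ l = 0 := by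
  have := mul_neg_geom_sum ω N
  rw [h, sub_self] at this
  exact (mul_eq_zero.1 this).resolve_left (sub_ne_zero.2 (Ne.symm h1))

/-- Allows θ to be replaced by y = a^(p-2) θ, whose p^s-th power is 1 mod p, with the same
embeddings. -/
theorem IsRadicalGenerator.smul {n : ℕ} {θ : K} {B : Module.Basis (Fin n) ℚ K} {ζ : ℂ}
    {σ : ℕ → K →+* ℂ} (h : IsRadicalGenerator n θ B ζ σ) {c : ℤ} (hc : c ≠ 0) :
    ∃ B' : Module.Basis (Fin n) ℚ K, IsRadicalGenerator n ((c : K) * θ) B' ζ σ ∧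
      ∀ β i, B.repr β i = (c : ℚ) ^ (i : ℕ) * B'.repr β i := by
  have hcQ : (c : ℚ) ≠ 0 := by exact_mod_cast hc
  refine ⟨B.unitsSMul (fun i => (Units.mk0 (c : ℚ) hcQ) ^ (i : ℕ)), ⟨?_, h.isPrimitiveRoot, ?_⟩, ?_⟩
  · intro i
    rw [Module.Basis.unitsSMul_apply, h.basis_apply, Units.smul_def, Algebra.smul_def]
    simp [mul_pow]
  · intro l
    rw [map_mul, map_mul, h.map_gen l]
    simp only [map_intCast]; ring
  · intro β i
    rw [Module.Basis.repr_unitsSMul, Units.smul_def]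
    simp [hcQ]

theorem IsRadicalGenerator.sum_repr {n : ℕ} {θ : K} {B : Module.Basis (Fin n) ℚ K} {ζ : ℂ}
    {σ : ℕ → K →+* ℂ} (h : IsRadicalGenerator n θ B ζ σ) (β : K) :
    β = ∑ i, (B.repr β i : K) * θ ^ (i : ℕ) := by
  conv_lhs => rw [← B.sum_repr β]
  exact Finset.sum_congr rfl fun i _ => by
    rw [h.basis_apply, Algebra.smul_def]; simp

/-- Each term `b_m θ ^ m` of an algebraic integer becomes integral after multiplication by `n`. -/
theorem IsRadicalGenerator.isIntegral_term {n : ℕ} {θ : K} {B : Module.Basis (Fin n) ℚ K} {ζ : ℂ}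
    {σ : ℕ → K →+* ℂ} (h : IsRadicalGenerator n θ B ζ σ) {β : K} (hβ : IsIntegral ℤ β)
    (m : Fin n) : IsIntegral ℤ ((n : K) * (B.repr β m : K) * θ ^ (m : ℕ)) := by
  have hζ := h.isPrimitiveRoot
  have hζint : IsIntegral ℤ ζ := hζ.isIntegral (Nat.pos_of_ne_zero (fun h0 => by
    subst h0; exact m.elim0))
  -- Discrete Fourier inversion: the weights ζ^(-ml) isolate the m-th term. The exponent n - m
  -- stands for -m in ℕ.
  have key : ∑ l ∈ Finset.range n, (ζ ^ (n - (m : ℕ))) ^ l * σ l β =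
      σ 0 ((n : K) * (B.repr β m : K) * θ ^ (m : ℕ)) := by
    have h1 : ∀ l, σ l β =
        ∑ i : Fin n, (B.repr β i : ℂ) * ((ζ ^ (i : ℕ)) ^ l * σ 0 θ ^ (i : ℕ)) := by
      intro l
      conv_lhs => rw [h.sum_repr β, map_sum]
      refine Finset.sum_congr rfl fun i _ => ?_
      rw [map_mul, map_pow, h.map_gen, map_ratCast, mul_pow, ← pow_mul, ← pow_mul, mul_comm l]
    simp_rw [h1, Finset.mul_sum]
    rw [Finset.sum_comm, Finset.sum_eq_single m]
    · rw [map_mul, map_mul, map_pow, map_natCast, map_ratCast, ← nsmul_eq_mul, smul_mul_assoc]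
      rw [Finset.sum_congr rfl (g := fun _ => (B.repr β m : ℂ) * σ 0 θ ^ (m : ℕ))]
      · simp
      · intro l _
        have : ζ ^ (n - (m : ℕ)) * ζ ^ (m : ℕ) = 1 := by
          rw [← pow_add, Nat.sub_add_cancel m.2.le, hζ.pow_eq_one]
        calc _ = (ζ ^ (n - (m : ℕ)) * ζ ^ (m : ℕ)) ^ l * ((B.repr β m : ℂ) * σ 0 θ ^ (m : ℕ)) := by
              ring
          _ = _ := by rw [this]; simp
    · intro i _ hi
      have hne : ζ ^ (n - (m : ℕ) + i) ≠ 1 := by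
        rw [Ne, hζ.pow_eq_one_iff_dvd]
        rintro ⟨e, he⟩
        have hm := m.2
        have hi2 := i.2
        have : (i : ℕ) ≠ m := fun h => hi (Fin.ext h)
        have he' : e = 1 := by
          have h1 : 0 < e := by
            rcases Nat.eq_zero_or_pos e with rfl | h
            · omega
            · exact h
          have h2 : e < 2 := by
            by_contra hcon
            have : n * 2 ≤ n * e := Nat.mul_le_mul_left _ (by omega)
            omega
          omega
        subst he'; omega
      have h0 := sum_range_pow_of_pow_eq_one (ω := ζ ^ (n - (m : ℕ) + i)) (N := n) (by
        rw [← pow_mul, mul_comm, pow_mul, hζ.pow_eq_one, one_pow]) hne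
      calc _ = (∑ l ∈ Finset.range n, (ζ ^ (n - (m : ℕ) + i)) ^ l) *
            ((B.repr β i : ℂ) * σ 0 θ ^ (i : ℕ)) := by
              rw [Finset.sum_mul]
              refine Finset.sum_congr rfl fun l _ => ?_
              rw [pow_add, mul_pow]; ring
        _ = 0 := by rw [h0, zero_mul]
    · simp
  have hInt : IsIntegral ℤ (σ 0 ((n : K) * (B.repr β m : K) * θ ^ (m : ℕ))) := by
    rw [← key]
    refine IsIntegral.sum _ fun l _ => ((hζint.pow _).pow _).mul ?_
    exact map_isIntegral_int (σ l) hβ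
  exact (isIntegral_algHom_iff ((σ 0).toIntAlgHom) (σ 0).injective).1 hInt

/-- `(∑_{i < p ^ k} Y ^ i) / p ^ k` for `Y = y ^ (p ^ (s - k))`. -/
def geomAvg {F : Type*} [Field F] (p s : ℕ) (y : F) (k : ℕ) : F :=
  (∑ i ∈ Finset.range (p ^ k), (y ^ p ^ (s - k)) ^ i) / (p : F) ^ k

/-- A partial trace, over the first p^d embeddings only: each term with i > 0 runs through powers of
a nontrivial p^d-th root of unity and cancels. -/
theorem IsRadicalGenerator.sum_map_geomAvg {p s : ℕ} (hp : p.Prime) {y : K}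
    {B : Module.Basis (Fin (p ^ s)) ℚ K} {ζ : ℂ} {σ : ℕ → K →+* ℂ}
    (h : IsRadicalGenerator (p ^ s) y B ζ σ) {k d : ℕ} (hkd : k ≤ d) (hds : d ≤ s) :
    ∑ l ∈ Finset.range (p ^ d), σ l (geomAvg p s y k) = ((p ^ (d - k) : ℕ) : ℂ) := by
  have hζ := h.isPrimitiveRoot
  have hp0 : (p : ℂ) ≠ 0 := by exact_mod_cast hp.ne_zero
  have h1 : ∀ l, σ l (geomAvg p s y k) =
      (∑ i ∈ Finset.range (p ^ k), (ζ ^ (p ^ (s - k) * i)) ^ l * (σ 0 y) ^ (p ^ (s - k) * i)) /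
        (p : ℂ) ^ k := by
    intro l
    rw [geomAvg, map_div₀, map_sum, map_pow, map_natCast]
    congr 1
    refine Finset.sum_congr rfl fun i _ => ?_
    rw [← pow_mul, map_pow, h.map_gen, mul_pow, ← pow_mul, ← pow_mul, mul_comm l]
  simp_rw [h1]
  rw [← Finset.sum_div, Finset.sum_comm, Finset.sum_eq_single 0]
  · simp only [mul_zero, pow_zero, one_pow, mul_one, Finset.sum_const, Finset.card_range,
      nsmul_eq_mul]
    rw [div_eq_iff (pow_ne_zero _ hp0)]
    push_cast
    rw [← pow_add, Nat.sub_add_cancel hkd]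
  · intro i hi hi0
    have hne : ζ ^ (p ^ (s - k) * i) ≠ 1 := by
      rw [Ne, hζ.pow_eq_one_iff_dvd]
      intro hdvd
      have hs : p ^ s = p ^ (s - k) * p ^ k := by rw [← pow_add, Nat.sub_add_cancel (hkd.trans hds)]
      rw [hs] at hdvd
      have := Nat.le_of_dvd (Nat.pos_of_ne_zero hi0)
        (Nat.dvd_of_mul_dvd_mul_left (pow_pos hp.pos _) hdvd)
      exact absurd (Finset.mem_range.1 hi) (not_lt.2 this)
    have h0 := sum_range_pow_of_pow_eq_one (ω := ζ ^ (p ^ (s - k) * i)) (N := p ^ d) (by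
      rw [← pow_mul, hζ.pow_eq_one_iff_dvd]
      refine ⟨p ^ (d - k) * i, ?_⟩
      have e1 : p ^ d = p ^ (d - k) * p ^ k := by rw [← pow_add, Nat.sub_add_cancel hkd]
      have e2 : p ^ s = p ^ (s - k) * p ^ k := by rw [← pow_add, Nat.sub_add_cancel (hkd.trans hds)]
      rw [e1, e2]; ring) hne
    rw [← Finset.sum_mul, h0, zero_mul]
  · intro hi
    exact absurd (Finset.mem_range.2 (pow_pos hp.pos _)) hi

theorem dvd_of_intCast_mem_radical {F : Type*} [Field F] [CharZero F] {p : ℕ} (hp : p.Prime) {T : ℤ}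
    (hT : (T : 𝓞 F) ∈ (Ideal.span {(p : 𝓞 F)}).radical) : (p : ℤ) ∣ T := by
  obtain ⟨N, hN⟩ := hT
  obtain ⟨γ, hγ⟩ := Ideal.mem_span_singleton'.1 hN
  have hp0 : (p : ℚ) ≠ 0 := by exact_mod_cast hp.ne_zero
  have h1 : algebraMap ℚ F ((T : ℚ) ^ N / p) = (γ : F) := by
    have := congrArg (fun x : 𝓞 F => (x : F)) hγ
    simp only [map_mul, map_natCast, map_pow, map_intCast] at this
    have hp0' : (p : F) ≠ 0 := by exact_mod_cast hp.ne_zero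
    simp only [map_div₀, map_pow, map_intCast, map_natCast]
    rw [div_eq_iff hp0', this]
  have h2 : IsIntegral ℤ ((T : ℚ) ^ N / p) :=
    (isIntegral_algebraMap_iff (algebraMap ℚ F).injective).1 (h1 ▸ γ.2)
  obtain ⟨t, ht⟩ := IsIntegrallyClosed.isIntegral_iff.1 h2
  rw [eq_div_iff hp0] at ht
  have h3 : t * p = T ^ N := by
    rw [eq_intCast] at ht
    exact_mod_cast ht
  exact (Nat.prime_iff_prime_int.1 hp).dvd_of_dvd_pow (Dvd.intro_left t h3)

/-- The elements `geomAvg p s y k`, `k ≤ d`, are linearly independent modulo the radical of `p`. -/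
theorem IsRadicalGenerator.dvd_of_sum_mem_radical {p s : ℕ} (hp : p.Prime) {y : K}
    {B : Module.Basis (Fin (p ^ s)) ℚ K} {ζ : ℂ} {σ : ℕ → K →+* ℂ}
    (h : IsRadicalGenerator (p ^ s) y B ζ σ) (D : ℕ → 𝓞 K) (x : ℕ → ℤ) :
    ∀ d ≤ s, (∀ k ≤ d, (D k : K) = geomAvg p s y k) →
      ∑ k ∈ Finset.range (d + 1), (x k : 𝓞 K) * D k ∈ (Ideal.span {(p : 𝓞 K)}).radical →
      ∀ k ≤ d, (p : ℤ) ∣ x k := by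
  intro d
  induction d with
  | zero =>
    intro _ hD hx k hk
    obtain rfl : k = 0 := by omega
    have hD0 : D 0 = 1 := by
      ext; rw [hD 0 le_rfl]; simp [geomAvg]
    simp only [zero_add, Finset.range_one, Finset.sum_singleton, hD0, mul_one] at hx
    exact dvd_of_intCast_mem_radical hp hx
  | succ d ih =>
    intro hds hD hx
    -- The sum over p^(d+1) embeddings turns the combination into ∑ x_k p^(d+1-k), which is x_(d+1)
    -- mod p. It is taken in `𝓞 ℂ`, where all conjugates live.
    have htop : (p : ℤ) ∣ x (d + 1) := by
      have h1 : ∀ l, RingOfIntegers.mapRingHom (σ l)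
          (∑ k ∈ Finset.range (d + 1 + 1), (x k : 𝓞 K) * D k) ∈
            (Ideal.span {(p : 𝓞 ℂ)}).radical := by
        intro l
        obtain ⟨N, hN⟩ := hx
        refine ⟨N, ?_⟩
        rw [← map_pow]
        have := Ideal.mem_map_of_mem (RingOfIntegers.mapRingHom (σ l)) hN
        rwa [Ideal.map_span, Set.image_singleton, map_natCast] at this
      have h2 := Ideal.sum_mem (t := Finset.range (p ^ (d + 1))) _ (fun l _ => h1 l)
      have h3 : ∑ l ∈ Finset.range (p ^ (d + 1)), RingOfIntegers.mapRingHom (σ l)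
          (∑ k ∈ Finset.range (d + 1 + 1), (x k : 𝓞 K) * D k) =
          ((∑ k ∈ Finset.range (d + 1 + 1), x k * (p : ℤ) ^ (d + 1 - k) : ℤ) : 𝓞 ℂ) := by
        ext
        change algebraMap (𝓞 ℂ) ℂ _ = algebraMap (𝓞 ℂ) ℂ _
        rw [map_sum]
        simp only [RingOfIntegers.mapRingHom_apply, map_sum, map_mul, map_intCast]
        rw [Finset.sum_comm]
        push_cast
        refine (Finset.sum_congr rfl fun k hk => ?_)
        have hk' : k ≤ d + 1 := by have := Finset.mem_range.1 hk; omega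
        rw [← Finset.mul_sum]
        congr 1
        rw [hD k hk', h.sum_map_geomAvg hp hk' hds]
        push_cast; rfl
      rw [h3] at h2
      have h4 := dvd_of_intCast_mem_radical hp h2
      rw [Finset.sum_range_succ] at h4
      refine (dvd_add_right (Finset.dvd_sum fun k hk => ?_)).1 (by simpa using h4)
      have hk' : k < d + 1 := Finset.mem_range.1 hk
      exact Dvd.dvd.mul_left (dvd_pow_self _ (by omega)) _
    intro k hk
    rcases Nat.lt_or_ge d k with hlt | hle
    · obtain rfl : k = d + 1 := by omega
      exact htop
    · refine ih (by omega) (fun k hk => hD k (by omega)) ?_ k hle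
      rw [Finset.sum_range_succ] at hx
      refine (Ideal.add_mem_iff_left _ ?_).1 hx
      refine Ideal.le_radical ?_
      obtain ⟨t, ht⟩ := htop
      rw [ht]
      refine Ideal.mem_span_singleton'.2 ⟨t * D (d + 1), ?_⟩
      push_cast; ring

end Conjugates

/-! ### Integrality of the averages and the counting argument. -/

section Counting

/-- Holds because v_p(i + 1) ≤ i and (i + 1) C(p^k, i + 1) is a multiple of p^k. -/
theorem exists_choose_mul_pow_eq {p : ℕ} (hp : p.Prime) (k i : ℕ) :
    ∃ w : ℕ, (p ^ k).choose (i + 1) * p ^ i = p ^ k * w := by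
  suffices h : p ^ k ∣ (p ^ k).choose (i + 1) * p ^ i from h
  obtain ⟨v, u, hu, huv⟩ := Nat.exists_eq_pow_mul_and_not_dvd (Nat.succ_ne_zero i) p hp.ne_one
  have hv : v ≤ i := by
    have h1 : p ^ v ≤ i + 1 := by
      rw [← Nat.succ_eq_add_one, huv]
      exact Nat.le_mul_of_pos_right _ (Nat.pos_of_ne_zero (by rintro rfl; exact hu (dvd_zero p)))
    have h2 : v < p ^ v := Nat.lt_pow_self hp.one_lt
    omega
  have hmain : p ^ k ∣ u * ((p ^ k).choose (i + 1) * p ^ i) := by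
    obtain ⟨m, hm⟩ : ∃ m, p ^ k = m + 1 :=
      ⟨p ^ k - 1, (Nat.succ_pred_eq_of_pos (pow_pos hp.pos k)).symm⟩
    have h3 := Nat.add_one_mul_choose_eq m i
    rw [← hm] at h3
    refine ⟨m.choose i * p ^ (i - v), ?_⟩
    have h4 : p ^ i = p ^ v * p ^ (i - v) := by rw [← pow_add, Nat.add_sub_cancel' hv]
    calc u * ((p ^ k).choose (i + 1) * p ^ i)
        = ((p ^ k).choose (i + 1) * (p ^ v * u)) * p ^ (i - v) := by rw [h4]; ring
      _ = (p ^ k * m.choose i) * p ^ (i - v) := by rw [← huv, Nat.succ_eq_add_one, h3]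
      _ = _ := by ring
  exact (Nat.Coprime.pow_left k ((Nat.Prime.coprime_iff_not_dvd hp).2 hu)).dvd_of_dvd_mul_left hmain

/-- With A - 1 = p^(k+1) h', the average D satisfies (Y - 1) D = p h', that is D + p h' = Y D.
Raising this to the power p^k, cancelling D^(p^k) and dividing by p^(k+1) h' leaves a monic equation
for D, integral by the binomial divisibility above. -/
theorem isIntegral_geom_sum_div {F : Type*} [Field F] [CharZero F] {p k : ℕ} (hp : p.Prime) {Y : F}
    {A : ℤ} (hY : Y ^ p ^ k = (A : F)) (hA : (p : ℤ) ^ (k + 1) ∣ A - 1) :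
    IsIntegral ℤ ((∑ i ∈ Finset.range (p ^ k), Y ^ i) / (p : F) ^ k) := by
  have hp0 : (p : F) ≠ 0 := by exact_mod_cast hp.ne_zero
  have hpk : (p : F) ^ k ≠ 0 := pow_ne_zero _ hp0
  obtain ⟨h', hh'⟩ := hA
  set D := (∑ i ∈ Finset.range (p ^ k), Y ^ i) / (p : F) ^ k with hD
  have hAF : (A : F) = 1 + (p : F) ^ k * (p * h') := by
    have : A = 1 + (p : ℤ) ^ k * (p * h') := by linear_combination hh'
    rw [this]; push_cast; ring
  have hDY : (Y - 1) * D = p * h' := by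
    rw [hD, mul_div_assoc', mul_comm, geom_sum_mul, hY, hAF, div_eq_iff hpk]; ring
  by_cases h0 : (h' : F) = 0
  · rw [h0, mul_zero] at hDY
    rcases mul_eq_zero.1 hDY with h | h
    · have hY1 : Y = 1 := sub_eq_zero.1 h
      have : D = 1 := by rw [hD, hY1]; simp [hpk]
      rw [this]; exact isIntegral_one
    · rw [h]; exact isIntegral_zero
  choose w hw using exists_choose_mul_pow_eq hp k
  set P := p ^ k with hP
  have hPpos : 0 < P := pow_pos hp.pos k
  have hexp : (D + p * h') ^ P = (1 + (P : F) * (p * h')) * D ^ P := by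
    have : D + p * h' = Y * D := by linear_combination -hDY
    rw [this, mul_pow, hY, hAF, hP]; push_cast; ring
  have hroot : D ^ P = ∑ i ∈ Finset.range P, ((w i * h' ^ i : ℤ) : F) * D ^ (P - (i + 1)) := by
    rw [add_comm D, add_pow, Finset.sum_range_succ'] at hexp
    simp only [pow_zero, one_mul, Nat.sub_zero, Nat.choose_zero_right, Nat.cast_one,
      mul_one] at hexp
    have hPh : (P : F) * (p * h') ≠ 0 := by
      rw [hP]; push_cast
      exact mul_ne_zero hpk (mul_ne_zero hp0 h0)
    refine mul_left_cancel₀ hPh ?_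
    rw [Finset.mul_sum]
    have h1 : (P : F) * (p * h') * D ^ P =
        ∑ i ∈ Finset.range P, (p * h' : F) ^ (i + 1) * D ^ (P - (i + 1)) * P.choose (i + 1) := by
      linear_combination -hexp
    rw [h1]
    refine Finset.sum_congr rfl fun i _ => ?_
    have h2 : (P.choose (i + 1) : F) * (p : F) ^ i = P * w i := by exact_mod_cast hw i
    push_cast
    calc _ = (p * h' : F) * h' ^ i * D ^ (P - (i + 1)) * (P.choose (i + 1) * (p : F) ^ i) := by ring
      _ = _ := by rw [h2]; ring
  let q : ℤ[X] := ∑ i ∈ Finset.range P, Polynomial.C (w i * h' ^ i : ℤ) * X ^ (P - (i + 1))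
  have hq : q.degree < P := by
    refine (degree_sum_le _ _).trans_lt ((Finset.sup_lt_iff (WithBot.bot_lt_coe P)).2 fun i _ => ?_)
    refine (degree_C_mul_X_pow_le _ _).trans_lt ?_
    exact Nat.cast_lt.2 (Nat.sub_lt hPpos (Nat.succ_pos i))
  refine ⟨X ^ P - q, monic_X_pow_sub hq, ?_⟩
  rw [eval₂_sub, eval₂_pow, eval₂_X, sub_eq_zero, hroot, eval₂_finsetSum]
  refine Finset.sum_congr rfl fun i _ => ?_
  simp only [eval₂_mul, eval₂_C, eval₂_pow, eval₂_X]
  rw [eq_intCast]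

variable {K : Type*} [Field K] [NumberField K]

theorem pow_dvd_of_mul_mem {p : ℕ} (hp : p.Prime) {z D : 𝓞 K} {d e : ℕ} (hde : d ≤ e)
    (hz : z ∈ (Ideal.span {(p : 𝓞 K)}).radical)
    (hT : ∀ x : ℤ, (x : 𝓞 K) * D ∈ (Ideal.span {(p : 𝓞 K)}).radical → (p : ℤ) ∣ x)
    (hlast : d < e → ∃ u : ℤ, z * D = (p : 𝓞 K) ^ (e - d + 1) * u) {x : ℤ}
    (hx : (x : 𝓞 K) * D ∈ Ideal.span {z} ⊔ Ideal.span {(p : 𝓞 K) ^ (e + 1)}) :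
    (p : ℤ) ^ (e - d + 1) ∣ x := by
  have hp0 : (p : 𝓞 K) ≠ 0 := by exact_mod_cast hp.ne_zero
  rcases hde.eq_or_lt with rfl | hlt
  · rw [Nat.sub_self, zero_add, pow_one]
    refine hT x (SetLike.le_def.1 (sup_le ?_ ?_) hx)
    · rwa [Ideal.span_singleton_le_iff_mem]
    · rw [Ideal.span_singleton_le_iff_mem]
      exact Ideal.pow_mem_of_mem _ (Ideal.le_radical (Ideal.mem_span_singleton_self _)) _
        (Nat.succ_pos _)
  obtain ⟨u, hu⟩ := hlast hlt
  obtain ⟨α', hα, γ', hγ, hsum⟩ := Submodule.mem_sup.1 hx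
  obtain ⟨α, rfl⟩ := Ideal.mem_span_singleton'.1 hα
  obtain ⟨γ, rfl⟩ := Ideal.mem_span_singleton'.1 hγ
  suffices h : ∀ j ≤ e - d + 1, (p : ℤ) ^ j ∣ x from h _ le_rfl
  intro j
  induction j with
  | zero => intro _; simp
  | succ j ih =>
    intro hj
    obtain ⟨x', rfl⟩ := ih (by omega)
    rw [pow_succ]
    -- Multiplying the relation for p^j x' D by x' D replaces z D by p^(e-d+1) u. As j ≤ e - d,
    -- cancelling p^j leaves a factor p, so (x' D)^2 ∈ (p).
    refine mul_dvd_mul_left _ (hT x' ⟨2, ?_⟩)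
    refine Ideal.mem_span_singleton'.2
      ⟨x' * (p ^ (e - d - j) * u * α + p ^ (e - j) * γ * D), ?_⟩
    refine mul_left_cancel₀ (pow_ne_zero j hp0) ?_
    have e1 : (p : 𝓞 K) ^ (e - d + 1) = p ^ j * p ^ (e - d - j) * p := by
      rw [← pow_add, ← pow_succ]; congr 1; omega
    have e2 : (p : 𝓞 K) ^ (e + 1) = p ^ j * p ^ (e - j) * p := by
      rw [← pow_add, ← pow_succ]; congr 1; omega
    rw [e1] at hu
    rw [e2] at hsum
    push_cast at hsum
    linear_combination (x' * D : 𝓞 K) * hsum - (x' * α : 𝓞 K) * hu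

/-- Modulo I = (z, p^(e+1)) there are at most p^(e+1) classes. Coefficients in [0, p) for D_0, …,
D_(d-1) and in [0, p^(e-d+1)) for D_d give p^(e+1) distinct ones, hence all of them. -/
theorem exists_sum_sub_mem {p : ℕ} (hp : p.Prime) {z : 𝓞 K} {D : ℕ → 𝓞 K} {d e : ℕ} (hde : d ≤ e)
    (hz : z ∈ (Ideal.span {(p : 𝓞 K)}).radical)
    (hN : ¬ p ^ (e + 2) ∣ Ideal.absNorm (Ideal.span {z}))
    (hT : ∀ x : ℕ → ℤ, ∑ k ∈ Finset.range (d + 1), (x k : 𝓞 K) * D k ∈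
      (Ideal.span {(p : 𝓞 K)}).radical → ∀ k ≤ d, (p : ℤ) ∣ x k)
    (hlast : d < e → ∃ u : ℤ, z * D d = (p : 𝓞 K) ^ (e - d + 1) * u) (β : 𝓞 K) :
    ∃ x : ℕ → ℤ, β - ∑ k ∈ Finset.range (d + 1), (x k : 𝓞 K) * D k ∈
      Ideal.span {z} ⊔ Ideal.span {(p : 𝓞 K)} := by
  set I := Ideal.span {z} ⊔ Ideal.span {(p : 𝓞 K) ^ (e + 1)} with hI
  have hIrad : I ≤ (Ideal.span {(p : 𝓞 K)}).radical := by
    refine sup_le ?_ ?_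
    · rwa [Ideal.span_singleton_le_iff_mem]
    · rw [Ideal.span_singleton_le_iff_mem]
      exact Ideal.pow_mem_of_mem _ (Ideal.le_radical (Ideal.mem_span_singleton_self _)) _
        (Nat.succ_pos _)
  have hcard : Nat.card (𝓞 K ⧸ I) ≤ p ^ (e + 1) := by
    have h1 : Ideal.absNorm I ∣ Ideal.absNorm (Ideal.span {z}) :=
      Ideal.absNorm_dvd_absNorm_of_le le_sup_left
    have h2 : Ideal.absNorm I ∣ Ideal.absNorm (Ideal.span {(p : 𝓞 K) ^ (e + 1)}) :=
      Ideal.absNorm_dvd_absNorm_of_le le_sup_right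
    rw [← Ideal.span_singleton_pow, map_pow, Ideal.absNorm_span_natCast, ← pow_mul] at h2
    obtain ⟨t, -, ht⟩ := (Nat.dvd_prime_pow hp).1 h2
    rw [← Submodule.cardQuot_apply, ← Ideal.absNorm_apply, ht]
    refine Nat.pow_le_pow_right hp.pos ?_
    by_contra hcon
    exact hN ((pow_dvd_pow p (by omega)).trans (ht ▸ h1))
  have hfin : Finite (𝓞 K ⧸ I) := by
    refine Ideal.finiteQuotientOfFreeOfNeBot I fun h => ?_
    have hmem : (p : 𝓞 K) ^ (e + 1) ∈ I := Ideal.mem_sup_right (Ideal.mem_span_singleton_self _)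
    rw [h, Ideal.mem_bot] at hmem
    exact pow_ne_zero _ (by exact_mod_cast hp.ne_zero) hmem
  let X : (Fin d → Fin p) × Fin (p ^ (e - d + 1)) → ℕ → ℤ := fun a k =>
    if h : k < d then ((a.1 ⟨k, h⟩ : ℕ) : ℤ) else ((a.2 : ℕ) : ℤ)
  let f : (Fin d → Fin p) × Fin (p ^ (e - d + 1)) → 𝓞 K ⧸ I := fun a =>
    Ideal.Quotient.mk I (∑ k ∈ Finset.range (d + 1), (X a k : 𝓞 K) * D k)
  have hinj : Function.Injective f := by
    intro a b hab
    have h1 : ∑ k ∈ Finset.range (d + 1), ((X a k - X b k : ℤ) : 𝓞 K) * D k ∈ I := by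
      have := Ideal.Quotient.eq.1 hab
      rw [← Finset.sum_sub_distrib] at this
      convert this using 2 with k
      push_cast; ring
    have h2 := hT _ (hIrad h1)
    have h3 : a.1 = b.1 := by
      funext ⟨k, hk⟩
      have h4 := h2 k hk.le
      simp only [X, dif_pos hk] at h4
      have ha := (a.1 ⟨k, hk⟩).2
      have hb := (b.1 ⟨k, hk⟩).2
      have h5 := Int.eq_zero_of_abs_lt_dvd h4 (by rw [abs_lt]; constructor <;> omega)
      exact Fin.ext (by omega)
    have h4 : ((X a d - X b d : ℤ) : 𝓞 K) * D d ∈ I := by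
      rw [Finset.sum_range_succ, Finset.sum_eq_zero, zero_add] at h1
      · exact h1
      · intro k hk
        have hk' := Finset.mem_range.1 hk
        simp only [X, dif_pos hk', h3, sub_self, Int.cast_zero, zero_mul]
    have h5 := pow_dvd_of_mul_mem hp hde hz (fun x hx => by
      have := hT (fun k => if k = d then x else 0) (by
        rw [Finset.sum_eq_single d]
        · simpa using hx
        · intro k _ hk; simp [hk]
        · simp) d le_rfl
      simpa using this) hlast h4
    have h6 : a.2 = b.2 := by
      simp only [X, lt_irrefl, dif_neg, not_false_eq_true] at h5
      have ha := a.2.2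
      have hb := b.2.2
      have hc : ((p ^ (e - d + 1) : ℕ) : ℤ) = (p : ℤ) ^ (e - d + 1) := by push_cast; rfl
      rw [← hc] at h5
      have := Int.eq_zero_of_abs_lt_dvd h5 (by rw [abs_lt]; constructor <;> omega)
      exact Fin.ext (by omega)
    exact Prod.ext h3 h6
  have hbij : Function.Bijective f := by
    refine hinj.bijective_of_nat_card_le (hcard.trans_eq ?_)
    rw [Nat.card_prod, Nat.card_fun, Nat.card_fin, Nat.card_fin, Nat.card_fin, ← pow_add]
    congr 1; omega
  obtain ⟨a, ha⟩ := hbij.2 (Ideal.Quotient.mk I β)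
  refine ⟨X a, ?_⟩
  have := Ideal.Quotient.eq.1 ha.symm
  refine SetLike.le_def.1 (sup_le_sup le_rfl ?_) this
  rw [Ideal.span_singleton_le_span_singleton]
  exact dvd_pow_self _ (Nat.succ_ne_zero _)

/-- Nakayama by hand: substituting the decomposition into itself raises the power of z until
nilpotency mod p absorbs it, and then raises the power of p. -/
theorem exists_sub_mem_span_pow {R : Type*} [CommRing R] {p z : R}
    (hz : z ∈ (Ideal.span {p}).radical)
    (M : AddSubgroup R) (hM : ∀ μ ∈ M, z * μ ∈ M) (hp : ∀ μ ∈ M, p * μ ∈ M)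
    (h : ∀ β, ∃ μ ∈ M, β - μ ∈ Ideal.span {z} ⊔ Ideal.span {p}) (N : ℕ) (β : R) :
    ∃ μ ∈ M, ∃ γ, β = μ + p ^ N * γ := by
  have h1 : ∀ j β, ∃ μ ∈ M, ∃ α γ, β = μ + z ^ j * α + p * γ := by
    intro j
    induction j with
    | zero => exact fun β => ⟨0, M.zero_mem, β, 0, by simp⟩
    | succ j ih =>
      intro β
      obtain ⟨μ, hμ, α, γ, rfl⟩ := ih β
      obtain ⟨μ', hμ', hα⟩ := h α
      obtain ⟨x, hx, y, hy, hxy⟩ := Submodule.mem_sup.1 hα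
      obtain ⟨α', rfl⟩ := Ideal.mem_span_singleton'.1 hx
      obtain ⟨γ', rfl⟩ := Ideal.mem_span_singleton'.1 hy
      have hzj : ∀ j, z ^ j * μ' ∈ M := by
        intro j
        induction j with
        | zero => simpa using hμ'
        | succ j ih' => rw [pow_succ', mul_assoc]; exact hM _ ih'
      refine ⟨μ + z ^ j * μ', M.add_mem hμ (hzj j), α', γ + z ^ j * γ', ?_⟩
      linear_combination -(z ^ j) * hxy
  obtain ⟨R', hR⟩ := hz
  obtain ⟨t, ht⟩ := Ideal.mem_span_singleton'.1 hR
  have h2 : ∀ β, ∃ μ ∈ M, ∃ γ, β = μ + p * γ := by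
    intro β
    obtain ⟨μ, hμ, α, γ, rfl⟩ := h1 R' β
    exact ⟨μ, hμ, t * α + γ, by rw [← ht]; ring⟩
  induction N generalizing β with
  | zero => exact ⟨0, M.zero_mem, β, by simp⟩
  | succ N ih =>
    obtain ⟨μ, hμ, γ, rfl⟩ := ih β
    obtain ⟨μ', hμ', γ', rfl⟩ := h2 γ
    have hpj : ∀ j, p ^ j * μ' ∈ M := by
      intro j
      induction j with
      | zero => simpa using hμ'
      | succ j ih' => rw [pow_succ', mul_assoc]; exact hp _ ih'
    exact ⟨μ + p ^ N * μ', M.add_mem hμ (hpj N), γ', by ring⟩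

end Counting

/-! ### Denominators of monomials and the triangular criterion. -/

section Coefficients

variable {K : Type*} [Field K] [NumberField K]

/-- The cofactor of `C n c m ^ n` in `|a| ^ m`. -/
def cofactor (n : ℕ) (c : ℕ → ℕ) (m : ℕ) : ℕ :=
  ∏ j ∈ Finset.Icc 1 (n - 1), c j ^ (j * m % n)

theorem natAbs_pow_eq {n : ℕ} {a : ℤ} {c : ℕ → ℕ}
    (hc : a.natAbs = ∏ j ∈ Finset.Icc 1 (n - 1), c j ^ j) (m : ℕ) :
    a.natAbs ^ m = C n c m ^ n * cofactor n c m := by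
  rw [hc, C, cofactor, ← Finset.prod_pow, ← Finset.prod_pow, ← Finset.prod_mul_distrib]
  refine Finset.prod_congr rfl fun j _ => ?_
  rw [← pow_mul, ← pow_mul, ← pow_add, mul_comm (j * m / n), Nat.div_add_mod]

theorem not_prime_pow_dvd_cofactor {n : ℕ} (hn : n ≠ 0) {c : ℕ → ℕ}
    (hc_sqf : ∀ j ∈ Finset.Icc 1 (n - 1), Squarefree (c j))
    (hc_cop : ∀ i ∈ Finset.Icc 1 (n - 1), ∀ j ∈ Finset.Icc 1 (n - 1), i ≠ j →
      Nat.Coprime (c i) (c j)) (m : ℕ) {l : ℕ} (hl : l.Prime) : ¬ l ^ n ∣ cofactor n c m := by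
  intro hdvd
  obtain ⟨j, hj, hlj⟩ := (hl.prime.dvd_finsetProd_iff _).1
    ((dvd_pow_self l hn).trans hdvd)
  have hlj := hl.dvd_of_dvd_pow hlj
  obtain ⟨c', hc'⟩ := hlj
  have hlc' : ¬ l ∣ c' := fun ⟨e, he⟩ => hl.one_lt.ne'
    (Nat.isUnit_iff.1 (hc_sqf j hj l ⟨e, by rw [hc', he]; ring⟩))
  rw [cofactor, ← Finset.mul_prod_erase _ _ hj] at hdvd
  have hcop : Nat.Coprime (l ^ n)
      (∏ i ∈ (Finset.Icc 1 (n - 1)).erase j, c i ^ (i * m % n)) := by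
    refine Nat.Coprime.pow_left _ (Nat.Coprime.prod_right fun i hi => Nat.Coprime.pow_right _ ?_)
    refine Nat.Coprime.coprime_dvd_left ⟨c', hc'⟩ ?_
    exact hc_cop j hj i (Finset.mem_of_mem_erase hi) (Finset.ne_of_mem_erase hi).symm
  have h1 := hcop.dvd_of_dvd_mul_right hdvd
  rw [hc', mul_pow] at h1
  have h2 : Nat.Coprime (l ^ n) (c' ^ (j * m % n)) :=
    Nat.Coprime.pow _ _ ((Nat.Prime.coprime_iff_not_dvd hl).2 hlc')
  have h3 := (Nat.pow_dvd_pow_iff_le_right hl.one_lt).1 (h2.dvd_of_dvd_mul_right h1)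
  exact absurd (Nat.mod_lt (j * m) (Nat.pos_of_ne_zero hn)) (not_lt.2 h3)

theorem exists_int_eq_of_pow_mul_eq {n R : ℕ} (hR : ∀ l : ℕ, l.Prime → ¬ l ^ n ∣ R) {q : ℚ} {N : ℤ}
    (h : q ^ n * R = N) : ∃ t : ℤ, q = t := by
  have hden : q.den = 1 := by
    by_contra hne
    obtain ⟨l, hl, hld⟩ := Nat.exists_prime_and_dvd hne
    refine hR l hl ((pow_dvd_pow_of_dvd hld n).trans ?_)
    have h1 : q.num ^ n * R = N * (q.den : ℤ) ^ n := by
      have hd : (q.den : ℚ) ≠ 0 := by exact_mod_cast q.den_nz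
      have : (q.num : ℚ) ^ n * R = N * (q.den : ℚ) ^ n := by
        rw [← h, ← Rat.mul_den_eq_num q, mul_pow]; ring
      exact_mod_cast this
    have h2 : ((q.den ^ n : ℕ) : ℤ) ∣ q.num ^ n * R := ⟨N, by rw [h1]; push_cast; ring⟩
    have h3 := Int.natAbs_dvd_natAbs.2 h2
    rw [Int.natAbs_natCast, Int.natAbs_mul, Int.natAbs_pow, Int.natAbs_natCast] at h3
    exact (Nat.Coprime.pow n n q.reduced.symm).dvd_of_dvd_mul_left h3
  exact ⟨q.num, (Rat.den_eq_one_iff q).1 hden |>.symm⟩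

theorem exists_int_pow_mul_pow_eq {F : Type*} [Field F] [CharZero F]
    {n m : ℕ} {a : ℤ} {θ : F} (hθ : θ ^ n = (a : F))
    {b : ℚ} (hb : IsIntegral ℤ ((b : F) * θ ^ m)) : ∃ N : ℤ, b ^ n * (a : ℚ) ^ m = N := by
  have h1 := hb.pow n
  have h2 : ((b : F) * θ ^ m) ^ n = algebraMap ℚ F (b ^ n * (a : ℚ) ^ m) := by
    rw [mul_pow, ← pow_mul, mul_comm m, pow_mul, hθ]
    simp
  rw [h2] at h1
  obtain ⟨N, hN⟩ := IsIntegrallyClosed.isIntegral_iff.1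
    ((isIntegral_algebraMap_iff (algebraMap ℚ F).injective).1 h1)
  exact ⟨N, by rw [← hN]; simp⟩

theorem exists_int_mul_of_isIntegral {F : Type*} [Field F] [CharZero F]
    {n m : ℕ} (hm : m < n) {a : ℤ} {θ : F}
    (hθ : θ ^ n = (a : F)) {b : ℚ} (hb : IsIntegral ℤ ((b : F) * θ ^ m)) :
    ∃ t : ℤ, (a : ℚ) * b = t := by
  obtain ⟨N, hN⟩ := exists_int_pow_mul_pow_eq hθ hb
  refine exists_int_eq_of_pow_mul_eq (n := n) (R := 1) (N := a ^ (n - m) * N)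
    (fun l hl hdvd => ?_) ?_
  · exact hl.one_lt.ne' (Nat.dvd_one.1 ((dvd_pow_self l (by omega)).trans hdvd))
  · push_cast
    rw [← hN, mul_one]
    have : (a : ℚ) ^ n = a ^ (n - m) * a ^ m := by
      rw [← pow_add, Nat.sub_add_cancel hm.le]
    rw [mul_pow, this]; ring

/-- Up to sign, (C_m b)^n times the cofactor is the integer b^n a^m; the cofactor is n-th power
free, so C_m b has no denominator. -/
theorem exists_int_C_mul_of_isIntegral {F : Type*} [Field F] [CharZero F]
    {n m : ℕ} (hn : n ≠ 0) {a : ℤ} {θ : F}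
    (hθ : θ ^ n = (a : F)) {c : ℕ → ℕ}
    (hc_sqf : ∀ j ∈ Finset.Icc 1 (n - 1), Squarefree (c j))
    (hc_cop : ∀ i ∈ Finset.Icc 1 (n - 1), ∀ j ∈ Finset.Icc 1 (n - 1), i ≠ j →
      Nat.Coprime (c i) (c j))
    (hc : a.natAbs = ∏ j ∈ Finset.Icc 1 (n - 1), c j ^ j)
    {b : ℚ} (hb : IsIntegral ℤ ((b : F) * θ ^ m)) :
    ∃ t : ℤ, (C n c m : ℚ) * b = t := by
  obtain ⟨N, hN⟩ := exists_int_pow_mul_pow_eq hθ hb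
  have h1 : (C n c m : ℚ) ^ n * cofactor n c m = |(a : ℚ)| ^ m := by
    have := natAbs_pow_eq hc m
    rw [← Int.cast_abs, Int.abs_eq_natAbs]
    exact_mod_cast this.symm
  have h2 : (C n c m * b) ^ n * cofactor n c m = b ^ n * |(a : ℚ)| ^ m := by
    rw [← h1]; ring
  have h3 : ∃ N' : ℤ, (C n c m * b) ^ n * cofactor n c m = N' := by
    rw [h2, ← abs_pow]
    rcases abs_choice ((a : ℚ) ^ m) with h4 | h4
    · exact ⟨N, by rw [h4, hN]⟩
    · exact ⟨-N, by rw [h4, mul_neg, hN]; push_cast; rfl⟩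
  obtain ⟨N', hN'⟩ := h3
  exact exists_int_eq_of_pow_mul_eq
    (fun l hl => not_prime_pow_dvd_cofactor hn hc_sqf hc_cop m hl) hN'

theorem IsRadicalGenerator.exists_int_mul_repr {n : ℕ} {a : ℤ} {θ : K} (hθ : θ ^ n = (a : K))
    {B : Module.Basis (Fin n) ℚ K} {ζ : ℂ} {σ : ℕ → K →+* ℂ} (h : IsRadicalGenerator n θ B ζ σ)
    {β : K} (hβ : IsIntegral ℤ β) (m : Fin n) : ∃ t : ℤ, (a : ℚ) * (n * B.repr β m) = t :=
  exists_int_mul_of_isIntegral m.2 hθ (by push_cast; exact h.isIntegral_term hβ m)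

theorem IsRadicalGenerator.exists_int_mul_C_mul_repr {n : ℕ} {a : ℤ} {θ : K}
    (hθ : θ ^ n = (a : K)) {B : Module.Basis (Fin n) ℚ K} {ζ : ℂ} {σ : ℕ → K →+* ℂ}
    (h : IsRadicalGenerator n θ B ζ σ) {c : ℕ → ℕ}
    (hc_sqf : ∀ j ∈ Finset.Icc 1 (n - 1), Squarefree (c j))
    (hc_cop : ∀ i ∈ Finset.Icc 1 (n - 1), ∀ j ∈ Finset.Icc 1 (n - 1), i ≠ j →
      Nat.Coprime (c i) (c j))
    (hc : a.natAbs = ∏ j ∈ Finset.Icc 1 (n - 1), c j ^ j)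
    {β : K} (hβ : IsIntegral ℤ β) (m : Fin n) :
    ∃ t : ℤ, (C n c m : ℚ) * (n * B.repr β m) = t :=
  exists_int_C_mul_of_isIntegral (fun h0 => by subst h0; exact m.elim0) hθ hc_sqf hc_cop hc
    (by push_cast; exact h.isIntegral_term hβ m)

theorem C_ne_zero {n : ℕ} {c : ℕ → ℕ} (hc_sqf : ∀ j ∈ Finset.Icc 1 (n - 1), Squarefree (c j))
    (m : ℕ) : C n c m ≠ 0 :=
  Finset.prod_ne_zero_iff.2 fun j hj => pow_ne_zero _ (hc_sqf j hj).ne_zero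

theorem isIntegral_pow_div_C {n : ℕ} (hn : n ≠ 0) {a : ℤ} {θ : K} (hθ : θ ^ n = (a : K)) {c : ℕ → ℕ}
    (hc_sqf : ∀ j ∈ Finset.Icc 1 (n - 1), Squarefree (c j))
    (hc : a.natAbs = ∏ j ∈ Finset.Icc 1 (n - 1), c j ^ j) (m : ℕ) :
    IsIntegral ℤ (θ ^ m / (C n c m : K)) := by
  refine IsIntegral.of_pow (Nat.pos_of_ne_zero hn) ?_
  have hC : (C n c m : K) ≠ 0 := by exact_mod_cast C_ne_zero hc_sqf m
  have h1 : (a.natAbs : ℤ) ^ m = C n c m ^ n * cofactor n c m := by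
    exact_mod_cast natAbs_pow_eq hc m
  have h2 : ∃ N : ℤ, (a : ℤ) ^ m = (C n c m : ℤ) ^ n * N := by
    rcases Int.natAbs_eq a with h | h
    · exact ⟨cofactor n c m, by rw [← h1, ← h]⟩
    · refine ⟨(-1) ^ m * cofactor n c m, ?_⟩
      conv_lhs => rw [h, neg_pow, h1]
      ring
  obtain ⟨N, hN⟩ := h2
  have h3 : (a : K) ^ m = (C n c m : K) ^ n * N := by exact_mod_cast congrArg (Int.cast : ℤ → K) hN
  have h4 : (θ ^ m / (C n c m : K)) ^ n = N := by
    rw [div_pow, ← pow_mul, mul_comm, pow_mul, hθ, h3, mul_div_cancel_left₀ _ (pow_ne_zero _ hC)]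
  rw [h4, ← eq_intCast (algebraMap ℤ K)]
  exact isIntegral_algebraMap

/-- Descent on the degree: subtracting the right multiple of e_m kills the leading coefficient.
Independence then follows from spanning and the rank. -/
theorem isIntegralBasis_of_triangular {n : ℕ} (B : Module.Basis (Fin n) ℚ K) (e : Fin n → K)
    (N : Fin n → ℕ) (hN : ∀ m, N m ≠ 0) (hInt : ∀ m, IsIntegral ℤ (e m))
    (hdiag : ∀ m, B.repr (e m) m = 1 / N m) (hlow : ∀ m i, m < i → B.repr (e m) i = 0)
    (hlead : ∀ β : K, IsIntegral ℤ β → ∀ m, (∀ i, m < i → B.repr β i = 0) →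
      ∃ t : ℤ, (N m : ℚ) * B.repr β m = t) : IsIntegralBasis e := by
  let e' : Fin n → 𝓞 K := fun m => ⟨e m, hInt m⟩
  have hspan : ∀ M : ℕ, M ≤ n → ∀ β : 𝓞 K, (∀ i : Fin n, M ≤ i → B.repr (β : K) i = 0) →
      β ∈ Submodule.span ℤ (Set.range e') := by
    intro M
    induction M with
    | zero =>
      intro _ β hβ
      have : (β : K) = 0 := by
        refine B.ext_elem fun i => ?_
        rw [hβ i (Nat.zero_le _)]; simp
      have hβ0 : β = 0 := by ext; simpa using this
      rw [hβ0]; exact Submodule.zero_mem _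
    | succ M ih =>
      intro hM β hβ
      let m : Fin n := ⟨M, hM⟩
      obtain ⟨t, ht⟩ := hlead (β : K) β.2 m fun i hi => hβ i hi
      have hNm : (N m : ℚ) ≠ 0 := by exact_mod_cast hN m
      have h1 : β - t • e' m ∈ Submodule.span ℤ (Set.range e') := by
        refine ih (by omega) _ fun i hi => ?_
        have h2 : ((β - t • e' m : 𝓞 K) : K) = (β : K) - (t : ℚ) • e m := by
          change algebraMap (𝓞 K) K _ = _
          rw [map_sub, zsmul_eq_mul, map_mul, map_intCast, Algebra.smul_def]
          simp only [map_intCast]; rfl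
        rw [h2, map_sub, map_smul, Finsupp.sub_apply, Finsupp.smul_apply, smul_eq_mul]
        rcases eq_or_lt_of_le hi with h | h
        · obtain rfl : m = i := Fin.ext h
          rw [hdiag, ← ht]; field_simp; ring
        · rw [hβ i h, hlow m i h]; ring
      have h3 := Submodule.add_mem _ h1
        (Submodule.smul_mem _ t (Submodule.subset_span (Set.mem_range_self m)))
      rwa [sub_add_cancel] at h3
  have htop : ⊤ ≤ Submodule.span ℤ (Set.range e') := fun β _ =>
    hspan n le_rfl β fun i hi => absurd i.2 (not_lt.2 hi)
  have hli : LinearIndependent ℤ e' := by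
    refine linearIndependent_of_top_le_span_of_card_eq_finrank htop ?_
    rw [RingOfIntegers.rank, Module.finrank_eq_card_basis B]
  exact ⟨Module.Basis.mk hli htop, fun i => by rw [Module.Basis.mk_apply]; rfl⟩

end Coefficients

/-! ### Identities between the averages. -/

section GeomAvg

variable {F : Type*} [Field F]

theorem geomAvg_zero (p s : ℕ) (y : F) : geomAvg p s y 0 = 1 := by simp [geomAvg]

theorem geom_sum_range_mul (Z : F) (p P : ℕ) :
    ∑ i ∈ Finset.range (p * P), Z ^ i =
      (∑ i ∈ Finset.range p, Z ^ i) * ∑ i ∈ Finset.range P, (Z ^ p) ^ i := by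
  induction P with
  | zero => simp
  | succ P ih =>
    rw [Nat.mul_succ, Finset.sum_range_add, ih, Finset.sum_range_succ _ P, mul_add, Finset.sum_mul]
    congr 1
    rw [Finset.sum_mul]
    refine Finset.sum_congr rfl fun i _ => ?_
    rw [pow_add, pow_mul, mul_comm]

theorem sub_one_mul_geomAvg {p s k : ℕ} (hk : k ≤ s) (y : F) :
    (y ^ p ^ (s - k) - 1) * geomAvg p s y k = (y ^ p ^ s - 1) / (p : F) ^ k := by
  rw [geomAvg, mul_div_assoc', mul_comm, geom_sum_mul, ← pow_mul, ← pow_add, Nat.sub_add_cancel hk]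

theorem mul_geomAvg_succ [CharZero F] {p s : ℕ} (hp : p.Prime) (y : F) {k : ℕ} (hk : k < s) :
    (p : F) * geomAvg p s y (k + 1) =
      (∑ i ∈ Finset.range p, y ^ (i * p ^ (s - (k + 1)))) * geomAvg p s y k := by
  have hp0 : (p : F) ≠ 0 := by exact_mod_cast hp.ne_zero
  have h1 : y ^ p ^ (s - k) = (y ^ p ^ (s - (k + 1))) ^ p := by
    rw [← pow_mul, ← pow_succ]; congr 2; omega
  simp only [geomAvg]
  rw [h1, pow_succ' p k, geom_sum_range_mul]
  simp_rw [mul_comm _ (p ^ (s - (k + 1))), pow_mul y]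
  rw [pow_succ]; field_simp

theorem pow_mul_geomAvg {p s k : ℕ} (y : F) (j : ℕ) :
    y ^ j * geomAvg p s y k =
      ∑ i ∈ Finset.range (p ^ k), 1 / (p : F) ^ k * y ^ (j + p ^ (s - k) * i) := by
  rw [geomAvg, Finset.sum_div, Finset.mul_sum]
  refine Finset.sum_congr rfl fun i _ => ?_
  rw [pow_add, pow_mul]; ring

end GeomAvg

/-! ### Leading coefficients for a generator y with y^(p^s) near 1. -/

section Lead

variable {K : Type*} [Field K] [NumberField K]

theorem IsRadicalGenerator.repr_pow {n : ℕ} {θ : K} {B : Module.Basis (Fin n) ℚ K} {ζ : ℂ}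
    {σ : ℕ → K →+* ℂ} (h : IsRadicalGenerator n θ B ζ σ) {e : ℕ} (he : e < n) (m : Fin n) :
    B.repr (θ ^ e) m = if e = m then 1 else 0 := by
  have := h.basis_apply ⟨e, he⟩
  rw [← this, B.repr_self, Finsupp.single_apply]
  simp [Fin.ext_iff]

theorem IsRadicalGenerator.repr_sum {n : ℕ} {θ : K} {B : Module.Basis (Fin n) ℚ K} {ζ : ℂ}
    {σ : ℕ → K →+* ℂ} (h : IsRadicalGenerator n θ B ζ σ) (S : Finset ℕ) (q : ℕ → ℚ) (e : ℕ → ℕ)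
    (he : ∀ i ∈ S, e i < n) (m : Fin n) :
    B.repr (∑ i ∈ S, (q i : K) * θ ^ e i) m = ∑ i ∈ S, if e i = m then q i else 0 := by
  rw [map_sum, Finsupp.finsetSum_apply]
  refine Finset.sum_congr rfl fun i hi => ?_
  have : (q i : K) * θ ^ e i = q i • θ ^ e i := by rw [Algebra.smul_def]; simp
  rw [this, map_smul, Finsupp.smul_apply, h.repr_pow (he i hi)]
  simp

theorem add_mul_pow_sub_le {p s k : ℕ} (hk : k ≤ s) {j : ℕ} {i : ℕ} (hi : i < p ^ k) :
    j + p ^ (s - k) * i ≤ p ^ s - p ^ (s - k) + j ∧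
      (j + p ^ (s - k) * i = p ^ s - p ^ (s - k) + j → p ≠ 0 → i = p ^ k - 1) := by
  have h1 : p ^ s = p ^ (s - k) * p ^ k := by rw [← pow_add, Nat.sub_add_cancel hk]
  obtain ⟨P, hP⟩ : ∃ P, p ^ k = P + 1 := ⟨p ^ k - 1, by omega⟩
  have h2 : p ^ s - p ^ (s - k) = p ^ (s - k) * P := by rw [h1, hP, Nat.mul_succ]; omega
  rw [hP] at hi
  rw [h2, hP]
  refine ⟨?_, fun h hp => ?_⟩
  · have := Nat.mul_le_mul_left (p ^ (s - k)) (Nat.lt_succ_iff.1 hi)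
    omega
  · have h3 : p ^ (s - k) * i = p ^ (s - k) * P := by omega
    have := Nat.eq_of_mul_eq_mul_left (pow_pos (Nat.pos_of_ne_zero hp) _) h3
    omega

theorem IsRadicalGenerator.repr_sum_range {p s : ℕ} (hp : p.Prime) {y : K}
    {B : Module.Basis (Fin (p ^ s)) ℚ K} {ζ : ℂ} {σ : ℕ → K →+* ℂ}
    (h : IsRadicalGenerator (p ^ s) y B ζ σ) {k : ℕ} (hk : k ≤ s) {j : ℕ}
    {m i : Fin (p ^ s)} (hm : p ^ s - p ^ (s - k) + j = m) (hmi : m ≤ i) (q : ℕ → ℚ) :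
    B.repr (∑ i ∈ Finset.range (p ^ k), (q i : K) * y ^ (j + p ^ (s - k) * i)) i =
      if i = m then q (p ^ k - 1) else 0 := by
  have hm2 := m.2
  rw [h.repr_sum (Finset.range (p ^ k)) q (fun i => j + p ^ (s - k) * i)]
  · rw [Finset.sum_eq_single (p ^ k - 1)]
    · have h2 : p ^ (s - k) * (p ^ k - 1) = p ^ s - p ^ (s - k) := by
        rw [Nat.mul_sub, mul_one, ← pow_add, Nat.sub_add_cancel hk]
      rw [h2, add_comm, hm]
      simp only [Fin.ext_iff, eq_comm]
    · intro i' hi' hne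
      rw [if_neg]
      intro hcon
      obtain ⟨h3, h4⟩ := add_mul_pow_sub_le (j := j) hk (Finset.mem_range.1 hi')
      have : (m : ℕ) ≤ i := hmi
      exact hne (h4 (by omega) hp.ne_zero)
    · intro hne
      exact absurd (Finset.mem_range.2 (Nat.sub_lt (pow_pos hp.pos k) one_pos)) hne
  · intro i' hi'
    have := (add_mul_pow_sub_le (j := j) hk (Finset.mem_range.1 hi')).1
    omega

theorem IsRadicalGenerator.repr_pow_mul_geomAvg {p s : ℕ} (hp : p.Prime) {y : K}
    {B : Module.Basis (Fin (p ^ s)) ℚ K} {ζ : ℂ} {σ : ℕ → K →+* ℂ}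
    (h : IsRadicalGenerator (p ^ s) y B ζ σ) {k : ℕ} (hk : k ≤ s) {j : ℕ}
    {m i : Fin (p ^ s)} (hm : p ^ s - p ^ (s - k) + j = m) (hmi : m ≤ i) :
    B.repr (y ^ j * geomAvg p s y k) i = if i = m then 1 / (p : ℚ) ^ k else 0 := by
  rw [← h.repr_sum_range hp hk hm hmi fun _ => 1 / (p : ℚ) ^ k, pow_mul_geomAvg]
  push_cast; rfl

/-- `κ` assigns to each `m < p ^ s` the largest `k ≤ d` with `p ^ s - p ^ (s - k) ≤ m`. -/
structure IsLevelFunction (p s d : ℕ) (κ : ℕ → ℕ) : Prop where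
  le : ∀ m, κ m ≤ d
  sub_le : ∀ m, p ^ s - p ^ (s - κ m) ≤ m
  lt : ∀ m, κ m < d → m < p ^ s - p ^ (s - (κ m + 1))

theorem IsLevelFunction.eq {p s d : ℕ} (hp : p.Prime) {κ : ℕ → ℕ} (hκ : IsLevelFunction p s d κ)
    {k m : ℕ} (hk : k ≤ d) (h1 : p ^ s - p ^ (s - k) ≤ m)
    (h2 : k < d → m < p ^ s - p ^ (s - (k + 1))) : κ m = k := by
  have hmono : ∀ {x y : ℕ}, x ≤ y → p ^ (s - y) ≤ p ^ (s - x) := fun hxy =>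
    Nat.pow_le_pow_right hp.pos (by omega)
  rcases lt_trichotomy (κ m) k with h | h | h
  · have h3 := hκ.lt m (h.trans_le hk)
    have h4 := hmono (Nat.succ_le_of_lt h)
    simp only [Nat.succ_eq_add_one] at h4
    omega
  · exact h
  · have h3 := h2 (h.trans_le (hκ.le m))
    have h4 := hκ.sub_le m
    have h5 := hmono (Nat.succ_le_of_lt h)
    simp only [Nat.succ_eq_add_one] at h5
    omega

/-- The element `y ^ j * geomAvg p s y (κ m)` whose `y`-degree is `m`. -/
def levelElement {F : Type*} [Field F] (p s : ℕ) (κ : ℕ → ℕ) (y : F) (m : ℕ) : F :=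
  y ^ (m - (p ^ s - p ^ (s - κ m))) * geomAvg p s y (κ m)

theorem IsRadicalGenerator.exists_int_of_mem_span {p s d : ℕ} (hp : p.Prime) {y : K}
    {B : Module.Basis (Fin (p ^ s)) ℚ K} {ζ : ℂ} {σ : ℕ → K →+* ℂ}
    (h : IsRadicalGenerator (p ^ s) y B ζ σ) (hd : d ≤ s) {κ : ℕ → ℕ}
    (hκ : IsLevelFunction p s d κ) {v : K}
    (hv : v ∈ Submodule.span ℤ (Set.range fun m : Fin (p ^ s) => levelElement p s κ y m))
    {m : Fin (p ^ s)} (hm : ∀ i, m < i → B.repr v i = 0) :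
    ∃ t : ℤ, (p : ℚ) ^ κ m * B.repr v m = t := by
  have hp0 : ∀ k : ℕ, (p : ℚ) ^ k ≠ 0 := fun k => pow_ne_zero _ (by exact_mod_cast hp.ne_zero)
  obtain ⟨t, rfl⟩ := (Submodule.mem_span_range_iff_exists_fun ℤ).1 hv
  have hrepr : ∀ i : Fin (p ^ s), (∀ j, i < j → t j = 0) →
      B.repr (∑ j, t j • levelElement p s κ y j) i = t i / (p : ℚ) ^ κ i := by
    intro i hi
    rw [map_sum, Finsupp.finsetSum_apply, Finset.sum_eq_single i]
    · rw [map_zsmul, Finsupp.smul_apply, levelElement, h.repr_pow_mul_geomAvg hp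
        ((hκ.le i).trans hd) (m := i) (by have := hκ.sub_le i; omega) le_rfl, if_pos rfl,
        zsmul_eq_mul, mul_one_div]
    · intro j _ hj
      rw [map_zsmul, Finsupp.smul_apply]
      rcases lt_or_gt_of_ne hj with hlt | hgt
      · rw [levelElement, h.repr_pow_mul_geomAvg hp ((hκ.le j).trans hd) (m := j)
          (by have := hκ.sub_le j; omega) hlt.le, if_neg hj.symm, smul_zero]
      · rw [hi j hgt, zero_smul]
    · simp
  have hzero : ∀ i, m < i → t i = 0 := by
    by_contra hcon
    push Not at hcon
    -- The largest index above m with t_i ≠ 0 would give v a nonzero coefficient there.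
    let S : Finset (Fin (p ^ s)) := Finset.univ.filter fun i => m < i ∧ t i ≠ 0
    have hS : S.Nonempty := by
      obtain ⟨i, hi⟩ := hcon
      exact ⟨i, Finset.mem_filter.2 ⟨Finset.mem_univ _, hi⟩⟩
    have hmax := Finset.mem_filter.1 (S.max'_mem hS)
    have h1 := hrepr (S.max' hS) fun j hj => by
      by_contra hne
      have := S.le_max' j (Finset.mem_filter.2 ⟨Finset.mem_univ _, hmax.2.1.trans hj, hne⟩)
      exact absurd hj (not_lt.2 this)
    rw [hm _ hmax.2.1, eq_comm, div_eq_zero_iff] at h1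
    rcases h1 with h1 | h1
    · exact hmax.2.2 (by exact_mod_cast h1)
    · exact hp0 _ h1
  exact ⟨t m, by rw [hrepr m hzero, mul_div_cancel₀ _ (hp0 _)]⟩

/-- Makes the span stable under y. Small j give level elements. Larger j are reduced by solving p
D_(k+1) = (1 + y^q + ⋯ + y^((p-1)q)) D_k for its top term when k < d, and by y^(p^(s-d)) D_d = D_d +
(A - 1)/p^d when k = d. -/
theorem pow_mul_geomAvg_mem_span {p s d : ℕ} (hp : p.Prime) (hd : d ≤ s) {κ : ℕ → ℕ}
    (hκ : IsLevelFunction p s d κ) {y : K} {A : ℤ} (hy : y ^ p ^ s = (A : K))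
    (hA : (p : ℤ) ^ d ∣ A - 1) (j : ℕ) : ∀ k ≤ d, y ^ j * geomAvg p s y k ∈
      Submodule.span ℤ (Set.range fun m : Fin (p ^ s) => levelElement p s κ y m) := by
  set V := Submodule.span ℤ (Set.range fun m : Fin (p ^ s) => levelElement p s κ y m) with hV
  have hpp : ∀ x : ℕ, 0 < p ^ x := fun x => pow_pos hp.pos x
  have hle : ∀ k, p ^ (s - k) ≤ p ^ s := fun k => Nat.pow_le_pow_right hp.pos (by omega)
  induction j using Nat.strong_induction_on with
  | _ j ih =>
    intro k hk
    have hbase : p ^ s - p ^ (s - k) + j < p ^ s →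
        (k < d → p ^ s - p ^ (s - k) + j < p ^ s - p ^ (s - (k + 1))) →
        y ^ j * geomAvg p s y k ∈ V := by
      intro h1 h2
      have hκm := hκ.eq hp hk (Nat.le_add_right _ j) h2
      have := Submodule.subset_span (R := ℤ) (s := Set.range fun m : Fin (p ^ s) =>
        levelElement p s κ y m) ⟨⟨_, h1⟩, rfl⟩
      simp only [levelElement, hκm, Nat.add_sub_cancel_left] at this
      exact this
    rcases hk.eq_or_lt with rfl | hkd
    · rcases lt_or_ge j (p ^ (s - k)) with hj | hj
      · exact hbase (by have := hle k; omega) fun h => absurd h (lt_irrefl _)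
      · have h1 := ih (j - p ^ (s - k)) (by have := hpp (s - k); omega)
        obtain ⟨t, ht⟩ := hA
        have h2 := sub_one_mul_geomAvg (p := p) hd y
        have hpk : (p : K) ^ k ≠ 0 := pow_ne_zero _ (by exact_mod_cast hp.ne_zero)
        have h3 : ((A : K) - 1) / (p : K) ^ k = t := by
          rw [div_eq_iff hpk]
          have : ((A - 1 : ℤ) : K) = ((p : ℤ) ^ k * t : ℤ) := by rw [ht]
          push_cast at this
          rw [this]; ring
        rw [hy, h3] at h2
        have h4 : y ^ j = y ^ (j - p ^ (s - k)) * y ^ p ^ (s - k) := by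
          rw [← pow_add, Nat.sub_add_cancel hj]
        have h5 : y ^ j * geomAvg p s y k = y ^ (j - p ^ (s - k)) * geomAvg p s y k +
            t • (y ^ (j - p ^ (s - k)) * geomAvg p s y 0) := by
          rw [geomAvg_zero, h4, zsmul_eq_mul]
          linear_combination y ^ (j - p ^ (s - k)) * h2
        rw [h5]
        exact V.add_mem (h1 k le_rfl) (V.smul_mem _ (h1 0 (Nat.zero_le _)))
    · have hks : k < s := hkd.trans_le hd
      set q := p ^ (s - (k + 1)) with hq
      have hqp : 0 < q := hpp _
      have hpq : p ^ (s - k) = p * q := by rw [hq, ← pow_succ']; congr 1; omega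
      obtain ⟨P, rfl⟩ : ∃ P, p = P + 1 := ⟨p - 1, (Nat.succ_pred_eq_of_pos hp.pos).symm⟩
      have hPpos : 0 < P := by have := hp.one_lt; omega
      have hpq' : (P + 1) ^ (s - k) = P * q + q := by rw [hpq]; ring
      have hPq : 0 < P * q := Nat.mul_pos hPpos hqp
      rcases lt_or_ge j (P * q) with hj | hj
      · refine hbase ?_ fun _ => ?_
        · have := hle k; omega
        · have := hle k; omega
      · have h1 := mul_geomAvg_succ hp y hks
        rw [← hq, Finset.sum_range_succ] at h1
        have h4 : y ^ j = y ^ (j - P * q) * y ^ (P * q) := by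
          rw [← pow_add, Nat.sub_add_cancel hj]
        have h5 : y ^ j * geomAvg (P + 1) s y k =
            ((P + 1 : ℕ) : ℤ) • (y ^ (j - P * q) * geomAvg (P + 1) s y (k + 1)) -
              ∑ i ∈ Finset.range P, y ^ (j - P * q + i * q) * geomAvg (P + 1) s y k := by
          rw [← Finset.sum_mul]
          simp_rw [pow_add]
          rw [← Finset.mul_sum, h4, zsmul_eq_mul]
          push_cast at h1 ⊢
          linear_combination -(y ^ (j - P * q)) * h1
        rw [h5]
        refine V.sub_mem (V.smul_mem _ (ih _ (by omega) _ hkd)) (V.sum_mem fun i hi => ih _ ?_ _ hk)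
        have : i * q < P * q := Nat.mul_lt_mul_of_pos_right (Finset.mem_range.1 hi) hqp
        omega

theorem isIntegral_geomAvg {p s k : ℕ} (hp : p.Prime) (hk : k ≤ s) {y : K} {A : ℤ}
    (hy : y ^ p ^ s = (A : K)) (hA : (p : ℤ) ^ (k + 1) ∣ A - 1) :
    IsIntegral ℤ (geomAvg p s y k) := by
  refine isIntegral_geom_sum_div hp (A := A) ?_ hA
  rw [← pow_mul, ← pow_add, Nat.sub_add_cancel hk, hy]

/-- Every algebraic integer `β` satisfies `A • β ∈ span` of the level elements. -/
theorem IsRadicalGenerator.mul_mem_span {p s : ℕ} (hp : p.Prime) {y : K} {A : ℤ}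
    (hy : y ^ p ^ s = (A : K)) {B : Module.Basis (Fin (p ^ s)) ℚ K} {ζ : ℂ} {σ : ℕ → K →+* ℂ}
    (h : IsRadicalGenerator (p ^ s) y B ζ σ) {ρ d : ℕ} (hd : d = min ρ s)
    (hA : (p : ℤ) ^ (ρ + 1) ∣ A - 1) (hA' : ¬ (p : ℤ) ^ (ρ + 2) ∣ A - 1)
    (hnorm : |Algebra.norm ℚ (y - 1)| = |(A : ℚ) - 1|) {κ : ℕ → ℕ} (hκ : IsLevelFunction p s d κ)
    {β : K} (hβ : IsIntegral ℤ β) :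
    (A : K) * β ∈ Submodule.span ℤ (Set.range fun m : Fin (p ^ s) => levelElement p s κ y m) := by
  have hds : d ≤ s := hd ▸ min_le_right _ _
  have hdρ : d ≤ ρ := hd ▸ min_le_left _ _
  have hyint : IsIntegral ℤ y := IsIntegral.of_pow (pow_pos hp.pos s) (by
    rw [hy, ← eq_intCast (algebraMap ℤ K)]; exact isIntegral_algebraMap)
  have hDint : ∀ k ≤ d, IsIntegral ℤ (geomAvg p s y k) := fun k hk =>
    isIntegral_geomAvg hp (hk.trans hds) hy ((pow_dvd_pow _ (by omega)).trans hA)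
  let D : ℕ → 𝓞 K := fun k => if hk : k ≤ d then ⟨geomAvg p s y k, hDint k hk⟩ else 0
  have hD : ∀ k ≤ d, algebraMap (𝓞 K) K (D k) = geomAvg p s y k := fun k hk => by
    have h1 : D k = ⟨geomAvg p s y k, hDint k hk⟩ := dif_pos hk
    rw [h1]; rfl
  let z : 𝓞 K := ⟨y, hyint⟩ - 1
  have hzK : algebraMap (𝓞 K) K z = y - 1 := rfl
  -- By the Frobenius congruence, A = (z + 1)^(p^s) ≡ z^(p^s) + 1 mod p, while A ≡ 1.
  have hz : z ∈ (Ideal.span {(p : 𝓞 K)}).radical := by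
    refine ⟨p ^ s, ?_⟩
    obtain ⟨r', hr'⟩ := exists_add_pow_prime_pow_eq hp z 1 s
    obtain ⟨t, ht⟩ := (dvd_pow_self (p : ℤ) (Nat.succ_ne_zero ρ)).trans hA
    have h1 : (z + 1) ^ p ^ s = (A : 𝓞 K) := by
      ext
      simp only [map_pow, map_add, map_one, map_intCast]
      rw [hzK, sub_add_cancel, hy]
    have h2 : (A : 𝓞 K) = p * t + 1 := by
      have : A = p * t + 1 := by linear_combination ht
      rw [this]; push_cast; ring
    rw [h1, h2] at hr'
    refine Ideal.mem_span_singleton'.2 ⟨t - z * r', ?_⟩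
    rw [one_pow] at hr'
    linear_combination hr'
  have hN : ¬ p ^ (ρ + 2) ∣ Ideal.absNorm (Ideal.span {z}) := by
    intro hdvd
    rw [Ideal.absNorm_span_singleton, ← Int.natCast_dvd] at hdvd
    refine hA' ?_
    have h1 : |Algebra.norm ℤ z| = |A - 1| := by
      have : (Algebra.norm ℤ z : ℚ) = Algebra.norm ℚ (algebraMap (𝓞 K) K z) :=
        Algebra.coe_norm_int z
      rw [hzK] at this
      rw [← this] at hnorm
      exact_mod_cast hnorm
    rw [← dvd_abs, ← h1, dvd_abs]
    exact_mod_cast hdvd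
  have hlast : d < ρ → ∃ u : ℤ, z * D d = (p : 𝓞 K) ^ (ρ - d + 1) * u := by
    intro hlt
    -- In this case (y - 1) D_s = (A - 1)/p^s is a rational integer.
    obtain rfl : d = s := by omega
    obtain ⟨t, ht⟩ := hA
    refine ⟨t, ?_⟩
    have h1 := sub_one_mul_geomAvg (p := p) (le_refl d) y
    have hpk : (p : K) ^ d ≠ 0 := pow_ne_zero _ (by exact_mod_cast hp.ne_zero)
    ext
    simp only [map_mul, map_pow, map_natCast, map_intCast]
    rw [hD d le_rfl, hzK]
    rw [Nat.sub_self, pow_zero, pow_one, hy] at h1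
    rw [h1, div_eq_iff hpk]
    have h2 : ((A - 1 : ℤ) : K) = ((p : ℤ) ^ (ρ + 1) * t : ℤ) := by rw [ht]
    push_cast at h2
    rw [h2, show ρ + 1 = (ρ - d + 1) + d by omega, pow_add]; ring
  have hcount := exists_sum_sub_mem hp hdρ hz hN
    (fun x hx => h.dvd_of_sum_mem_radical hp D x d hds hD hx) hlast
  set V := Submodule.span ℤ (Set.range fun m : Fin (p ^ s) => levelElement p s κ y m) with hV
  have hmem := pow_mul_geomAvg_mem_span hp hds hκ hy ((pow_dvd_pow _ (by omega)).trans hA)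
  have hyV : ∀ v ∈ V, y * v ∈ V := by
    intro v hv
    induction hv using Submodule.span_induction with
    | mem v hv =>
      obtain ⟨m, rfl⟩ := hv
      simp only [levelElement]
      rw [← mul_assoc, ← pow_succ']
      exact hmem _ _ (hκ.le m)
    | zero => simp
    | add v w _ _ hv hw => rw [mul_add]; exact V.add_mem hv hw
    | smul t v _ hv => rw [mul_smul_comm]; exact V.smul_mem _ hv
  let M : AddSubgroup (𝓞 K) := V.toAddSubgroup.comap (algebraMap (𝓞 K) K).toAddMonoidHom
  have hMmem : ∀ μ : 𝓞 K, μ ∈ M ↔ algebraMap (𝓞 K) K μ ∈ V := fun μ => Iff.rfl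
  obtain ⟨μ, hμ, γ, hγ⟩ := exists_sub_mem_span_pow hz M
    (fun μ hμ => by
      rw [hMmem] at hμ ⊢
      rw [map_mul, hzK, sub_mul, one_mul]
      exact V.sub_mem (hyV _ hμ) hμ)
    (fun μ hμ => by
      rw [hMmem] at hμ ⊢
      rw [map_mul, map_natCast, ← nsmul_eq_mul]
      exact V.nsmul_mem hμ p)
    (fun β => by
      obtain ⟨x, hx⟩ := hcount β
      refine ⟨_, M.sum_mem fun k hk => ?_, hx⟩
      have hk' : k ≤ d := by have := Finset.mem_range.1 hk; omega
      rw [hMmem, map_mul, map_intCast, ← zsmul_eq_mul, hD k hk']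
      have := hmem 0 k hk'
      rw [pow_zero, one_mul] at this
      exact V.smul_mem _ this) s ⟨β, hβ⟩
  have hβK : β = algebraMap (𝓞 K) K μ + (p : K) ^ s * algebraMap (𝓞 K) K γ := by
    have h1 : β = algebraMap (𝓞 K) K ⟨β, hβ⟩ := rfl
    rw [h1, hγ]; simp
  -- The exponent s was chosen so that p^s clears the Fourier denominator of γ, and A clears the
  -- rest: A p^s γ ∈ ℤ[y].
  rw [hβK, mul_add]
  refine V.add_mem ?_ ?_
  · rw [← zsmul_eq_mul]; exact V.smul_mem _ hμ
  · rw [h.sum_repr (algebraMap (𝓞 K) K γ), Finset.mul_sum, Finset.mul_sum]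
    refine V.sum_mem fun i _ => ?_
    obtain ⟨t, ht⟩ := h.exists_int_mul_repr hy γ.2 i
    have h1 : (A : K) * ((p : K) ^ s * ((B.repr (algebraMap (𝓞 K) K γ) i : K) * y ^ (i : ℕ))) =
        t • (y ^ (i : ℕ) * geomAvg p s y 0) := by
      have h2 : ((A : ℚ) * (((p ^ s : ℕ) : ℚ) * B.repr (algebraMap (𝓞 K) K γ) i) : ℚ) = t := ht
      have h3 := congrArg (Rat.cast : ℚ → K) h2
      push_cast at h3
      rw [geomAvg_zero, mul_one, zsmul_eq_mul, ← h3]; ring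
    rw [h1]
    exact V.smul_mem _ (hmem _ 0 (Nat.zero_le _))

end Lead

/-! ### Valuations of a^(p-1) - 1 and of its powers. -/

section Arithmetic

theorem exists_mul_eq_sub_two_mul_pow_add_one {p s : ℕ} (hp : p.Prime) (hs : 1 ≤ s) :
    ∃ e, (p - 2) * p ^ s + 1 = (p - 1) * e ∧ ¬ p ∣ e := by
  obtain ⟨q, rfl⟩ : ∃ q, p = q + 2 := ⟨p - 2, by have := hp.two_le; omega⟩
  obtain ⟨t, ht⟩ : ∃ t, (q + 2) ^ s = (q + 1) * t + 1 := by
    have h1 : (q + 2) ^ s ≡ 1 ^ s [MOD q + 1] := by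
      refine Nat.ModEq.pow s ?_
      simp [Nat.ModEq, show q + 2 = 1 + (q + 1) by ring]
    rw [one_pow] at h1
    obtain ⟨t, ht⟩ := (Nat.modEq_iff_dvd' (Nat.one_le_pow _ _ (by omega))).1 h1.symm
    exact ⟨t, by have : 1 ≤ (q + 2) ^ s := Nat.one_le_pow _ _ (by omega)
                 omega⟩
  have hmain : (q + 2 - 2) * (q + 2) ^ s + 1 = (q + 2 - 1) * (q * t + 1) := by
    rw [show q + 2 - 2 = q by omega, show q + 2 - 1 = q + 1 by omega, ht]; ring
  refine ⟨q * t + 1, hmain, fun hdvd => ?_⟩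
  have h2 : q + 2 ∣ (q + 2 - 2) * (q + 2) ^ s + 1 := hmain ▸ hdvd.mul_left _
  have h3 : q + 2 ∣ (q + 2 - 2) * (q + 2) ^ s := (dvd_pow_self _ (by omega)).mul_left _
  exact hp.one_lt.ne' (Nat.dvd_one.1 ((Nat.dvd_add_right h3).1 h2))

/-- The cofactor ∑ x^i is congruent to e mod p, hence prime to p. -/
theorem pow_dvd_pow_sub_one_iff {p e N : ℕ} (hp : p.Prime) (he : ¬ p ∣ e) {x : ℤ}
    (hx : (p : ℤ) ∣ x - 1) : (p : ℤ) ^ N ∣ x ^ e - 1 ↔ (p : ℤ) ^ N ∣ x - 1 := by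
  have hsum : ¬ (p : ℤ) ∣ ∑ i ∈ Finset.range e, x ^ i := by
    intro hdvd
    have h1 : ∑ i ∈ Finset.range e, x ^ i ≡ ∑ i ∈ Finset.range e, 1 [ZMOD p] := by
      refine Int.ModEq.sum fun i _ => ?_
      simpa using ((Int.modEq_iff_dvd.2 hx).symm.pow i : x ^ i ≡ 1 ^ i [ZMOD p])
    have h2 := h1.dvd_iff.1 hdvd
    simp only [Finset.sum_const, Finset.card_range, mul_one, nsmul_eq_mul] at h2
    exact he (by exact_mod_cast h2)
  have hcop : IsCoprime ((p : ℤ) ^ N) (∑ i ∈ Finset.range e, x ^ i) :=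
    IsCoprime.pow_left (((Nat.prime_iff_prime_int.1 hp).coprime_iff_not_dvd).2 hsum)
  rw [← geom_sum_mul]
  exact ⟨fun h => hcop.dvd_of_dvd_mul_left h, fun h => h.mul_left _⟩

theorem not_dvd_of_r_nonneg {p : ℕ} (hp : p.Prime) {a : ℤ} (hr : 0 ≤ r p a) : ¬ (p : ℤ) ∣ a := by
  intro hdvd
  have h1 : ¬ (p : ℤ) ∣ a ^ (p - 1) - 1 := by
    intro h2
    have h3 := hdvd.trans (dvd_pow_self a (by have := hp.two_le; omega : p - 1 ≠ 0))
    have h4 : (p : ℤ) ∣ 1 := by simpa using dvd_sub h3 h2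
    exact (Nat.prime_iff_prime_int.1 hp).not_dvd_one h4
  have h2 := padicValInt.eq_zero_of_not_dvd h1
  rw [r, h2] at hr
  omega

theorem pow_dvd_iff_of_r_nonneg {p : ℕ} (hp : p.Prime) {a : ℤ} (hr : 0 ≤ r p a) (N : ℕ) :
    (p : ℤ) ^ N ∣ a ^ (p - 1) - 1 ↔ N ≤ (r p a).toNat + 1 := by
  have := Fact.mk hp
  rw [padicValInt_dvd_iff]
  -- `padicValInt` is 0 at 0, so a^(p-1) = 1 would make r = -1.
  have h1 : a ^ (p - 1) - 1 ≠ 0 := by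
    intro h0
    simp [r, h0] at hr
  have h2 : padicValInt p (a ^ (p - 1) - 1) = (r p a).toNat + 1 := by
    rw [r] at hr ⊢; omega
  rw [h2]
  exact ⟨fun h => h.resolve_left h1, Or.inr⟩

theorem isLevelFunction_k {p s : ℕ} {a : ℤ} {d' : ℕ} (hd : (d p s a).toNat = d') :
    IsLevelFunction p s d' (k p s a) where
  le m := hd ▸ Nat.findGreatest_le _
  sub_le m := Nat.findGreatest_spec (P := fun i => p ^ s - p ^ (s - i) ≤ m) (m := 0)
    (Nat.zero_le _) (by simp)
  lt m hm := by
    have := Nat.findGreatest_is_greatest (P := fun i => p ^ s - p ^ (s - i) ≤ m)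
      (n := (d p s a).toNat) (k := k p s a m + 1) (Nat.lt_succ_self _) (by omega)
    exact not_le.1 this

theorem not_dvd_C {n p : ℕ} (hn : n ≠ 0) (hp : p.Prime) {a : ℤ} (ha : ¬ (p : ℤ) ∣ a) {c : ℕ → ℕ}
    (hc : a.natAbs = ∏ j ∈ Finset.Icc 1 (n - 1), c j ^ j) (m : ℕ) : ¬ p ∣ C n c m := by
  intro hdvd
  have h1 := (hdvd.trans (dvd_pow_self _ hn)).trans (Dvd.intro _ (natAbs_pow_eq hc m).symm)
  exact ha (Int.natCast_dvd.2 (hp.dvd_of_dvd_pow h1))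

end Arithmetic

/-! ### The case p ∤ a. -/

section CoprimeRadicand

variable {K : Type*} [Field K] [NumberField K]

theorem IsRadicalGenerator.exists_int_lead {p s : ℕ} (hp : p.Prime) (hs : 1 ≤ s) {a : ℤ}
    (hirr : Irreducible (X ^ p ^ s - Polynomial.C a : ℤ[X])) {θ : K}
    (hθ : θ ^ p ^ s = (a : K)) (hK : IntermediateField.adjoin ℚ {θ} = ⊤) {c : ℕ → ℕ}
    (hc_sqf : ∀ j ∈ Finset.Icc 1 (p ^ s - 1), Squarefree (c j))
    (hc_cop : ∀ i ∈ Finset.Icc 1 (p ^ s - 1), ∀ j ∈ Finset.Icc 1 (p ^ s - 1),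
      i ≠ j → Nat.Coprime (c i) (c j))
    (hc : a.natAbs = ∏ j ∈ Finset.Icc 1 (p ^ s - 1), c j ^ j) (hr : 0 ≤ r p a)
    {B : Module.Basis (Fin (p ^ s)) ℚ K} {ζ : ℂ} {σ : ℕ → K →+* ℂ}
    (h : IsRadicalGenerator (p ^ s) θ B ζ σ) {β : K} (hβ : IsIntegral ℤ β) (m : Fin (p ^ s))
    (hm : ∀ i, m < i → B.repr β i = 0) :
    ∃ t : ℤ, ((p ^ k p s a m * C (p ^ s) c m : ℕ) : ℚ) * B.repr β m = t := by
  have hpa := not_dvd_of_r_nonneg hp hr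
  have ha0 : a ≠ 0 := by rintro rfl; exact hpa (dvd_zero _)
  obtain ⟨e, he, hpe⟩ := exists_mul_eq_sub_two_mul_pow_add_one hp hs
  set u : ℤ := a ^ (p - 2) with hu
  set A : ℤ := u ^ p ^ s * a with hA
  have hu0 : u ≠ 0 := pow_ne_zero _ ha0
  have hAe : A = (a ^ (p - 1)) ^ e := by
    rw [hA, hu, ← pow_mul, ← pow_mul, ← pow_succ, he]
  have hx : (p : ℤ) ∣ a ^ (p - 1) - 1 := by
    have := (pow_dvd_iff_of_r_nonneg hp hr 1).2 (by omega)
    rwa [pow_one] at this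
  have hAdvd : ∀ N : ℕ, (p : ℤ) ^ N ∣ A - 1 ↔ N ≤ (r p a).toNat + 1 := fun N => by
    rw [hAe, pow_dvd_pow_sub_one_iff hp hpe hx, pow_dvd_iff_of_r_nonneg hp hr]
  obtain ⟨B', h', hBB'⟩ := h.smul hu0
  have hy : ((u : K) * θ) ^ p ^ s = (A : K) := by rw [mul_pow, hθ, hA]; push_cast; rfl
  have hnorm := norm_mul_sub_one (pow_pos hp.pos s).ne' hirr hθ hK
    (c := (u : ℚ)) (by exact_mod_cast hu0)
  have hκ : IsLevelFunction p s (min (r p a).toNat s) (k p s a) :=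
    isLevelFunction_k (by rw [d]; omega)
  have hmem := h'.mul_mem_span hp hy rfl ((hAdvd _).2 le_rfl) (fun hcon => by
    have := (hAdvd _).1 hcon
    omega) (by
    rw [Rat.cast_intCast] at hnorm
    rw [hnorm, hA]; push_cast; rfl) hκ hβ
  have hAβ : ∀ i, B'.repr ((A : K) * β) i = A * B'.repr β i := fun i => by
    have : (A : K) * β = (A : ℚ) • β := by rw [Algebra.smul_def]; simp
    rw [this, map_smul, Finsupp.smul_apply, smul_eq_mul]
  obtain ⟨t, ht⟩ := h'.exists_int_of_mem_span hp (min_le_right _ _) hκ hmem (m := m) fun i hi => by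
    have h1 := hm i hi
    rw [hBB', mul_eq_zero] at h1
    rw [hAβ, h1.resolve_left (pow_ne_zero _ (by exact_mod_cast hu0)), mul_zero]
  obtain ⟨t', ht'⟩ := h.exists_int_mul_C_mul_repr hθ hc_sqf hc_cop hc hβ m
  -- One bound has the stray factor A, the other p^s; a Bézout relation removes both.
  have hcop : IsCoprime A ((p : ℤ) ^ s) := by
    rw [hAe]
    have h1 := (Nat.prime_iff_prime_int.1 hp).coprime_iff_not_dvd.2 hpa
    exact h1.symm.pow_left.pow_left.pow_right
  obtain ⟨x, y, hxy⟩ := hcop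
  have hxyQ : (x : ℚ) * A + y * (p : ℚ) ^ s = 1 := by exact_mod_cast hxy
  rw [hAβ] at ht
  refine ⟨x * u ^ (m : ℕ) * C (p ^ s) c m * t + y * p ^ k p s a m * t', ?_⟩
  push_cast at ht' ⊢
  rw [← ht, ← ht']
  calc (p : ℚ) ^ k p s a m * C (p ^ s) c m * B.repr β m
      = (x * A + y * (p : ℚ) ^ s) * (p ^ k p s a m * C (p ^ s) c m * B.repr β m) := by
        rw [hxyQ, one_mul]
    _ = x * A * p ^ k p s a m * C (p ^ s) c m * B.repr β m +
        y * (p : ℚ) ^ s * (p ^ k p s a m * C (p ^ s) c m * B.repr β m) := by ring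
    _ = _ := by
      conv_lhs => enter [1]; rw [hBB']
      ring

theorem isIntegral_of_isIntegral_mul {F : Type*} [Field F] {p k N : ℕ}
    (hcop : Nat.Coprime (p ^ k) N) {x : F}
    (h1 : IsIntegral ℤ ((p : F) ^ k * x)) (h2 : IsIntegral ℤ ((N : F) * x)) : IsIntegral ℤ x := by
  obtain ⟨u, v, huv⟩ := Nat.isCoprime_iff_coprime.2 hcop
  have h3 : (u : F) * (p : F) ^ k + v * N = 1 := by
    have := congrArg (Int.cast : ℤ → F) huv
    push_cast at this
    exact this
  have h4 : x = u • ((p : F) ^ k * x) + v • ((N : F) * x) := by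
    rw [zsmul_eq_mul, zsmul_eq_mul]
    linear_combination -x * h3
  rw [h4]
  exact (h1.smul u).add (h2.smul v)

/-- Both the p^κ-multiple and the C_m-multiple are integral, and p ∤ C_m. The choice of w makes the
second an integer multiple of θ^m plus one of θ^j times the average of the powers of a'Y; the choice
of a' makes that average integral. -/
theorem isIntegral_add_delta_div {p s : ℕ} (hp : p.Prime) {a : ℤ} {θ : K}
    (hθ : θ ^ p ^ s = (a : K)) {c : ℕ → ℕ}
    (hc_sqf : ∀ j ∈ Finset.Icc 1 (p ^ s - 1), Squarefree (c j))
    (hc : a.natAbs = ∏ j ∈ Finset.Icc 1 (p ^ s - 1), c j ^ j) (hr : 0 ≤ r p a) {a' w : ℤ} {m : ℕ}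
    (h1 : k p s a m < s → a' ≡ a ^ ((p - 2) * p ^ (s - k p s a m - 1))
      [ZMOD (p : ℤ) ^ (k p s a m + 1)])
    (h2 : k p s a m = s → a' ≡ a ^ (p - 2) [ZMOD (p : ℤ) ^ (k p s a m + 1)])
    (h3 : w * (C (p ^ s) c m : ℤ) * a' ^ (p ^ k p s a m - 1) ≡ 1 [ZMOD (p : ℤ) ^ k p s a m]) :
    IsIntegral ℤ ((θ ^ m + delta p s a c θ a' w m) /
      ((p : K) ^ k p s a m * (C (p ^ s) c m : K))) := by
  have hpa := not_dvd_of_r_nonneg hp hr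
  have hκ : IsLevelFunction p s (min (r p a).toNat s) (k p s a) :=
    isLevelFunction_k (by rw [d]; omega)
  have hks : k p s a m ≤ s := (hκ.le m).trans (min_le_right _ _)
  have hkr : k p s a m ≤ (r p a).toNat := (hκ.le m).trans (min_le_left _ _)
  have hsub := hκ.sub_le m
  set κ := k p s a m with hκdef
  set Cm := C (p ^ s) c m with hCm
  have hC0 : (Cm : K) ≠ 0 := by exact_mod_cast C_ne_zero hc_sqf m
  have hp0 : (p : K) ^ κ ≠ 0 := pow_ne_zero _ (by exact_mod_cast hp.ne_zero)
  have hθint : IsIntegral ℤ θ := IsIntegral.of_pow (pow_pos hp.pos s) (by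
    rw [hθ, ← eq_intCast (algebraMap ℤ K)]; exact isIntegral_algebraMap)
  have hInt : ∀ t : ℤ, IsIntegral ℤ (t : K) := fun t => by
    rw [← eq_intCast (algebraMap ℤ K)]; exact isIntegral_algebraMap
  obtain ⟨P, hP⟩ : ∃ P, p ^ κ = P + 1 :=
    ⟨p ^ κ - 1, (Nat.succ_pred_eq_of_pos (pow_pos hp.pos κ)).symm⟩
  have hm : m = j p s a m + p ^ (s - κ) * P := by
    have e1 : p ^ s = p ^ (s - κ) * p ^ κ := by rw [← pow_add, Nat.sub_add_cancel hks]
    rw [hP, Nat.mul_succ] at e1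
    simp only [j, ← hκdef]
    omega
  set j' := j p s a m with hj'
  set Y := θ ^ p ^ (s - κ) with hY
  have hYpow : Y ^ p ^ κ = a := by rw [hY, ← pow_mul, ← pow_add, Nat.sub_add_cancel hks, hθ]
  have hdelta : delta p s a c θ a' w m =
      (w : K) * Cm * θ ^ j' * ∑ i ∈ Finset.range P, ((a' : K) * Y) ^ i := by
    rw [delta, ← hκdef, hP, Nat.add_sub_cancel]
  have hθm : θ ^ m = θ ^ j' * Y ^ P := by rw [hY, ← pow_mul, ← pow_add, ← hm]
  have hcop : Nat.Coprime (p ^ κ) Cm :=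
    Nat.Coprime.pow_left _ ((Nat.Prime.coprime_iff_not_dvd hp).2
      (not_dvd_C (pow_pos hp.pos s).ne' hp hpa hc m))
  refine isIntegral_of_isIntegral_mul hcop ?_ ?_
  · have e1 : (p : K) ^ κ * ((θ ^ m + delta p s a c θ a' w m) / ((p : K) ^ κ * Cm)) =
        θ ^ m / Cm + w * (θ ^ j' * ∑ i ∈ Finset.range P, ((a' : K) * Y) ^ i) := by
      rw [hdelta]; field_simp
    rw [e1]
    refine (isIntegral_pow_div_C (pow_pos hp.pos s).ne' hθ hc_sqf hc m).add
      ((hInt w).mul ((hθint.pow _).mul (IsIntegral.sum _ fun i _ => ?_)))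
    exact ((hInt a').mul (hθint.pow _)).pow i
  · rw [hP, Nat.add_sub_cancel] at h3
    obtain ⟨t, ht⟩ := h3.dvd
    have htK : (w : K) * Cm * (a' : K) ^ P = 1 - (p : K) ^ κ * t := by
      have := congrArg (Int.cast : ℤ → K) ht
      push_cast at this
      linear_combination -this
    have e1 : (Cm : K) * ((θ ^ m + delta p s a c θ a' w m) / ((p : K) ^ κ * Cm)) =
        t * (θ ^ j' * Y ^ P) + ((w * Cm : ℤ) : K) * (θ ^ j' *
          ((∑ i ∈ Finset.range (p ^ κ), ((a' : K) * Y) ^ i) / (p : K) ^ κ)) := by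
      rw [hdelta, hθm, hP, Finset.sum_range_succ, mul_pow]
      push_cast
      field_simp
      linear_combination (-(θ ^ j' * Y ^ P)) * htK
    rw [e1]
    refine ((hInt t).mul ((hθint.pow _).mul ((hθint.pow _).pow _))).add
      ((hInt _).mul ((hθint.pow _).mul ?_))
    refine isIntegral_geom_sum_div hp (A := a' ^ p ^ κ * a) ?_ ?_
    · rw [mul_pow, hYpow]; push_cast; rfl
    · have hx : a ^ (p - 1) ≡ 1 [ZMOD (p : ℤ) ^ (κ + 1)] :=
        (Int.modEq_iff_dvd.2 ((pow_dvd_iff_of_r_nonneg hp hr (κ + 1)).2 (by omega))).symm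
      -- The exponent (p-2)p^f + 1 is a multiple of p - 1, and a^(p-1) ≡ 1 mod p^(κ+1).
      have hfin : ∀ f, a' ^ p ^ κ * a ≡ a ^ ((p - 2) * p ^ f + 1) [ZMOD (p : ℤ) ^ (κ + 1)] →
          (p : ℤ) ^ (κ + 1) ∣ a' ^ p ^ κ * a - 1 := by
        intro f hf
        obtain ⟨e, he⟩ : p - 1 ∣ (p - 2) * p ^ f + 1 := by
          rcases Nat.eq_zero_or_pos f with rfl | hf
          · exact ⟨1, by have := hp.two_le; rw [pow_zero]; omega⟩
          · exact (exists_mul_eq_sub_two_mul_pow_add_one hp hf).imp fun e he => he.1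
        rw [he, pow_mul] at hf
        have := hx.pow e
        rw [one_pow] at this
        exact (hf.trans this).symm.dvd
      rcases hks.lt_or_eq with hlt | heq
      · refine hfin (s - 1) ?_
        refine (((h1 hlt).pow (p ^ κ)).mul_right a).trans ?_
        rw [← pow_mul, ← pow_succ, mul_assoc, ← pow_add, show s - κ - 1 + κ = s - 1 by omega]
      · refine hfin κ ?_
        refine (((h2 heq).pow (p ^ κ)).mul_right a).trans ?_
        rw [← pow_mul, ← pow_succ]

theorem IsRadicalGenerator.repr_add_delta_div {p s : ℕ} (hp : p.Prime) {a : ℤ} {θ : K}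
    {B : Module.Basis (Fin (p ^ s)) ℚ K} {ζ : ℂ} {σ : ℕ → K →+* ℂ}
    (h : IsRadicalGenerator (p ^ s) θ B ζ σ) {c : ℕ → ℕ}
    (hc_sqf : ∀ j ∈ Finset.Icc 1 (p ^ s - 1), Squarefree (c j)) (hr : 0 ≤ r p a) (a' w : ℤ)
    {m i : Fin (p ^ s)} (hmi : m ≤ i) :
    B.repr ((θ ^ (m : ℕ) + delta p s a c θ a' w m) /
      ((p : K) ^ k p s a m * (C (p ^ s) c m : K))) i =
      if i = m then 1 / ((p ^ k p s a m * C (p ^ s) c m : ℕ) : ℚ) else 0 := by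
  have hκ : IsLevelFunction p s (min (r p a).toNat s) (k p s a) :=
    isLevelFunction_k (by rw [d]; omega)
  have hks : k p s a m ≤ s := (hκ.le m).trans (min_le_right _ _)
  have hsub := hκ.sub_le m
  have hC0 : (C (p ^ s) c m : K) ≠ 0 := by exact_mod_cast C_ne_zero hc_sqf m
  have hm : p ^ s - p ^ (s - k p s a m) + j p s a m = m := by
    rw [j]; omega
  obtain ⟨P, hP⟩ : ∃ P, p ^ k p s a m = P + 1 :=
    ⟨p ^ k p s a m - 1, (Nat.succ_pred_eq_of_pos (pow_pos hp.pos _)).symm⟩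
  have hp0 : (p : K) ^ k p s a m ≠ 0 := pow_ne_zero _ (by exact_mod_cast hp.ne_zero)
  have hmP : j p s a m + p ^ (s - k p s a m) * P = m := by
    have e1 : p ^ s = p ^ (s - k p s a m) * p ^ k p s a m := by
      rw [← pow_add, Nat.sub_add_cancel hks]
    rw [hP, Nat.mul_succ] at e1
    omega
  let q : ℕ → ℚ := fun i => if i = P then 1 / ((p ^ k p s a m * C (p ^ s) c m : ℕ) : ℚ)
    else w * a' ^ i / (p : ℚ) ^ k p s a m
  have hq : (θ ^ (m : ℕ) + delta p s a c θ a' w m) / ((p : K) ^ k p s a m * C (p ^ s) c m) =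
      ∑ i ∈ Finset.range (p ^ k p s a m),
        (q i : K) * θ ^ (j p s a m + p ^ (s - k p s a m) * i) := by
    rw [hP, Finset.sum_range_succ, hmP, add_comm (∑ _ ∈ _, _), add_div, delta, hP,
      Nat.add_sub_cancel]
    congr 1
    · simp only [q, if_true]; push_cast; ring
    · rw [Finset.mul_sum, Finset.sum_div]
      refine Finset.sum_congr rfl fun i hi => ?_
      simp only [q, if_neg (Finset.mem_range.1 hi).ne]
      push_cast
      rw [pow_add, pow_mul, mul_pow]
      field_simp
  rw [hq, h.repr_sum_range hp hks hm hmi q, show p ^ k p s a m - 1 = P by omega]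
  simp only [q, if_true]

end CoprimeRadicand

/-! ### The case p ∣ a. -/

section DivisibleRadicand

variable {K : Type*} [Field K] [NumberField K]

theorem dvd_of_r_eq_neg_one {p s : ℕ} (hp : p.Prime) (hs : 1 ≤ s) {a : ℤ}
    (hirr : Irreducible (X ^ p ^ s - Polynomial.C a : ℤ[X])) (hr : r p a = -1) : (p : ℤ) ∣ a := by
  have := Fact.mk hp
  by_contra hpa
  have hn : 1 < p ^ s := Nat.one_lt_pow (by omega) hp.one_lt
  have h1 : (p : ℤ) ∣ a ^ (p - 1) - 1 := (Int.ModEq.pow_card_sub_one_eq_one hp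
    ((Nat.prime_iff_prime_int.1 hp).coprime_iff_not_dvd.2 hpa).symm).symm.dvd
  -- If p ∤ a, Fermat leaves valuation 0 only through the default value at 0. Then a is a root of
  -- X^(p^s) - a, against irreducibility.
  have h2 : a ^ (p - 1) = 1 := by
    have h3 : padicValInt p (a ^ (p - 1) - 1) = 0 := by rw [r] at hr; omega
    have h4 := (padicValInt_dvd_iff (p := p) 1 (a ^ (p - 1) - 1)).1 (by simpa using h1)
    rcases h4 with h4 | h4
    · linarith
    · omega
  have h3 : a ^ p ^ s = a := by
    obtain ⟨t, ht⟩ : p - 1 ∣ p ^ s - 1 := by simpa using Nat.sub_dvd_pow_sub_pow p 1 s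
    rw [show p ^ s = (p - 1) * t + 1 by omega, pow_succ, pow_mul, h2, one_pow, one_mul]
  have h4 : (X - Polynomial.C a : ℤ[X]) ∣ X ^ p ^ s - Polynomial.C a :=
    dvd_iff_isRoot.2 (by simp [h3])
  obtain ⟨g, hg⟩ := h4
  have hmon : (X ^ p ^ s - Polynomial.C a : ℤ[X]).Monic := monic_X_pow_sub_C _ (by omega)
  have hgmon : g.Monic := (monic_X_sub_C a).of_mul_monic_left (hg ▸ hmon)
  have hdeg := congrArg natDegree hg
  rw [(monic_X_sub_C a).natDegree_mul hgmon, natDegree_X_sub_C, natDegree_X_pow_sub_C] at hdeg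
  rcases hirr.isUnit_or_isUnit hg with h5 | h5
  · exact not_isUnit_X_sub_C a h5
  · have := natDegree_eq_zero_of_isUnit h5
    omega

theorem IsRadicalGenerator.exists_int_C_mul_repr {p s : ℕ} (hp : p.Prime) (hs : 1 ≤ s) {a : ℤ}
    (ha0 : a ≠ 0) (hJ : ¬ p ∣ padicValInt p a) {θ : K}
    (hθ : θ ^ p ^ s = (a : K)) {c : ℕ → ℕ}
    (hc_sqf : ∀ j ∈ Finset.Icc 1 (p ^ s - 1), Squarefree (c j))
    (hc_cop : ∀ i ∈ Finset.Icc 1 (p ^ s - 1), ∀ j ∈ Finset.Icc 1 (p ^ s - 1),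
      i ≠ j → Nat.Coprime (c i) (c j))
    (hc : a.natAbs = ∏ j ∈ Finset.Icc 1 (p ^ s - 1), c j ^ j)
    {B : Module.Basis (Fin (p ^ s)) ℚ K} {ζ : ℂ} {σ : ℕ → K →+* ℂ}
    (h : IsRadicalGenerator (p ^ s) θ B ζ σ) {β : K} (hβ : IsIntegral ℤ β) (m : Fin (p ^ s)) :
    ∃ t : ℤ, (C (p ^ s) c m : ℚ) * B.repr β m = t := by
  have := Fact.mk hp
  have hp0 : (p : K) ≠ 0 := by exact_mod_cast hp.ne_zero
  have hn : 1 < p ^ s := Nat.one_lt_pow (by omega) hp.one_lt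
  obtain ⟨a₀, ha₀⟩ := padicValInt_dvd (p := p) a
  have hpa₀ : ¬ (p : ℤ) ∣ a₀ := by
    rintro ⟨b, rfl⟩
    have h1 : (p : ℤ) ^ (padicValInt p a + 1) ∣ a := ⟨b, by
      conv_lhs => rw [ha₀]
      ring⟩
    rcases (padicValInt_dvd_iff _ _).1 h1 with h2 | h2
    · exact ha0 h2
    · omega
  set J := padicValInt p a with hJdef
  have hcop : Nat.Coprime J (p ^ s) :=
    (Nat.Coprime.pow_left s ((Nat.Prime.coprime_iff_not_dvd hp).2 hJ)).symm
  obtain ⟨u, -, hu⟩ := Nat.exists_mul_mod_eq_one_of_coprime hcop hn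
  -- With J u = p^s v + 1, the element π = θ^u / p^v satisfies π^(p^s) = p a₀^u.
  set v := J * u / p ^ s with hv
  have huv : J * u = p ^ s * v + 1 := by rw [hv, ← hu, Nat.div_add_mod]
  have hπpow : (θ ^ u / (p : K) ^ v) ^ p ^ s = ((p * a₀ ^ u : ℤ) : K) := by
    have hpn : (p : K) ^ (p ^ s * v) ≠ 0 := pow_ne_zero _ hp0
    rw [div_pow, ← pow_mul, ← pow_mul, mul_comm u, mul_comm v, pow_mul θ, hθ, div_eq_iff hpn]
    rw [ha₀]; push_cast
    rw [mul_pow, ← pow_mul, huv, pow_succ]; ring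
  have hInt : IsIntegral ℤ (θ ^ u / (p : K) ^ v) := IsIntegral.of_pow (pow_pos hp.pos s) (by
    rw [hπpow, ← eq_intCast (algebraMap ℤ K)]; exact isIntegral_algebraMap)
  let π : 𝓞 K := ⟨θ ^ u / (p : K) ^ v, hInt⟩
  have hπK : algebraMap (𝓞 K) K π = θ ^ u / (p : K) ^ v := rfl
  have hπn : π ^ p ^ s = ((p * a₀ ^ u : ℤ) : 𝓞 K) := by
    ext
    simp only [map_pow, map_intCast]
    exact hπpow
  have hz : π ∈ (Ideal.span {(p : 𝓞 K)}).radical := by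
    refine ⟨p ^ s, Ideal.mem_span_singleton'.2 ⟨(a₀ : 𝓞 K) ^ u, ?_⟩⟩
    rw [hπn]; push_cast; ring
  have hrank : Module.finrank ℤ (𝓞 K) = p ^ s := by
    rw [RingOfIntegers.rank, Module.finrank_eq_card_basis B, Fintype.card_fin]
  have hN : ¬ p ^ (0 + 2) ∣ Ideal.absNorm (Ideal.span {π}) := by
    have h1 : Ideal.absNorm (Ideal.span {π}) = (p * a₀ ^ u : ℤ).natAbs := by
      refine Nat.pow_left_injective (n := p ^ s) (by omega) ?_
      simp only
      rw [← map_pow, Ideal.span_singleton_pow, hπn, Ideal.absNorm_span_singleton,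
        ← eq_intCast (algebraMap ℤ (𝓞 K)), Algebra.norm_algebraMap, hrank, Int.natAbs_pow]
    rw [h1, Int.natAbs_mul, Int.natAbs_natCast, Int.natAbs_pow, zero_add, pow_two]
    intro hdvd
    exact hpa₀ (Int.natCast_dvd.2 (hp.dvd_of_dvd_pow (Nat.dvd_of_mul_dvd_mul_left hp.pos hdvd)))
  -- The ideal norm of (π) has exactly one factor p, so ℤ alone fills the quotient (d = e = 0).
  have hcount := exists_sum_sub_mem (D := fun _ => 1) hp le_rfl hz hN
    (fun x hx k hk => by
      obtain rfl : k = 0 := by omega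
      refine dvd_of_intCast_mem_radical hp (F := K) ?_
      simpa using hx) (fun h => absurd h (lt_irrefl 0))
  let M : AddSubgroup (𝓞 K) := AddSubgroup.closure (Set.range fun i : ℕ => π ^ i)
  have hmem : ∀ i : ℕ, π ^ i ∈ M := fun i => AddSubgroup.subset_closure ⟨i, rfl⟩
  have hM : ∀ μ ∈ M, π * μ ∈ M := by
    intro μ hμ
    induction hμ using AddSubgroup.closure_induction with
    | mem x hx => obtain ⟨i, rfl⟩ := hx; rw [← pow_succ']; exact hmem _
    | zero => rw [mul_zero]; exact M.zero_mem
    | add x y _ _ hx hy => rw [mul_add]; exact M.add_mem hx hy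
    | neg x _ hx => rw [mul_neg]; exact M.neg_mem hx
  have hMcoeff : ∀ μ ∈ M, ∃ t : ℤ, (C (p ^ s) c m : ℚ) * B.repr (algebraMap (𝓞 K) K μ) m = t := by
    intro μ hμ
    induction hμ using AddSubgroup.closure_induction with
    | mem x hx =>
      obtain ⟨i, rfl⟩ := hx
      have hlt := Nat.mod_lt (u * i) (by omega : 0 < p ^ s)
      set b : ℚ := (a : ℚ) ^ (u * i / p ^ s) / (p : ℚ) ^ (v * i) with hb
      have h1 : algebraMap (𝓞 K) K (π ^ i) = (b : K) * θ ^ (u * i % p ^ s) := by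
        rw [map_pow, hπK, div_pow, ← pow_mul, ← pow_mul, hb]
        conv_lhs => rw [← Nat.div_add_mod (u * i) (p ^ s), pow_add, pow_mul, hθ]
        push_cast; ring
      have h2 : (b : K) * θ ^ (u * i % p ^ s) = b • θ ^ (u * i % p ^ s) := by
        rw [Algebra.smul_def]; simp
      have h3 : IsIntegral ℤ ((b : K) * θ ^ (u * i % p ^ s)) := h1 ▸ (π ^ i).2
      simp only
      rw [h1, h2, map_smul, Finsupp.smul_apply, h.repr_pow hlt, smul_eq_mul]
      split_ifs with h4
      · rw [h4] at h3
        rw [mul_one]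
        exact exists_int_C_mul_of_isIntegral (by omega) hθ hc_sqf hc_cop hc h3
      · exact ⟨0, by simp⟩
    | zero => exact ⟨0, by simp⟩
    | add x y _ _ hx hy =>
      obtain ⟨t₁, h₁⟩ := hx
      obtain ⟨t₂, h₂⟩ := hy
      exact ⟨t₁ + t₂, by rw [map_add, map_add, Finsupp.add_apply, mul_add, h₁, h₂]; push_cast; rfl⟩
    | neg x _ hx =>
      obtain ⟨t, ht⟩ := hx
      exact ⟨-t, by rw [map_neg, map_neg, Finsupp.neg_apply, mul_neg, ht]; push_cast; rfl⟩
  obtain ⟨μ, hμ, γ, hγ⟩ := exists_sub_mem_span_pow hz M hM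
    (fun μ hμ => by rw [← nsmul_eq_mul]; exact M.nsmul_mem hμ p)
    (fun β => by
      obtain ⟨x, hx⟩ := hcount β
      refine ⟨_, ?_, hx⟩
      rw [zero_add, Finset.sum_range_one, ← zsmul_eq_mul]
      exact M.zsmul_mem (by simpa using hmem 0) _) s ⟨β, hβ⟩
  have hβK : β = algebraMap (𝓞 K) K μ + ((p ^ s : ℕ) : ℚ) • algebraMap (𝓞 K) K γ := by
    have h1 : β = algebraMap (𝓞 K) K ⟨β, hβ⟩ := rfl
    rw [h1, hγ, Algebra.smul_def]; simp
  obtain ⟨t₁, h₁⟩ := hMcoeff μ hμ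
  obtain ⟨t₂, h₂⟩ := h.exists_int_mul_C_mul_repr hθ hc_sqf hc_cop hc
    (β := algebraMap (𝓞 K) K γ) γ.2 m
  refine ⟨t₁ + t₂, ?_⟩
  rw [hβK, map_add, map_smul, Finsupp.add_apply, Finsupp.smul_apply, smul_eq_mul, mul_add, h₁, h₂]
  push_cast; rfl

end DivisibleRadicand

end PureField

/-! ### Assembly of the two cases. -/

theorem theorem3p3 {K : Type*} [Field K] [NumberField K] (p s : ℕ) (hp : p.Prime) (hs : 1 ≤ s)
    (a : ℤ) (hirr : Irreducible (X ^ p ^ s - C a : ℤ[X]))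
    (θ : K) (hθ : θ ^ p ^ s = (a : K)) (hK : IntermediateField.adjoin ℚ {θ} = ⊤)
    (c : ℕ → ℕ)
    (hc_sqf : ∀ j ∈ Finset.Icc 1 (p ^ s - 1), Squarefree (c j))
    (hc_cop : ∀ i ∈ Finset.Icc 1 (p ^ s - 1), ∀ j ∈ Finset.Icc 1 (p ^ s - 1),
      i ≠ j → Nat.Coprime (c i) (c j))
    (hc : a.natAbs = ∏ j ∈ Finset.Icc 1 (p ^ s - 1), c j ^ j)
    (hpa : ¬ p ∣ Int.gcd a (padicValInt p a)) :
    ((PureField.r p a = 0 ∨ PureField.r p a = -1) →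
      PureField.IsIntegralBasis
        (fun m : Fin (p ^ s) => θ ^ (m : ℕ) / (PureField.C (p ^ s) c m : K))) ∧
    (1 ≤ PureField.r p a →
      ∀ a' w : ℕ → ℤ,
        (∀ m : ℕ, Nat.totient (p ^ s) ≤ m → m < p ^ s →
          (PureField.k p s a m < s →
            a' m ≡ a ^ ((p - 2) * p ^ (s - PureField.k p s a m - 1))
              [ZMOD (p : ℤ) ^ (PureField.k p s a m + 1)]) ∧
          (PureField.k p s a m = s →
            a' m ≡ a ^ (p - 2) [ZMOD (p : ℤ) ^ (PureField.k p s a m + 1)]) ∧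
          w m * (PureField.C (p ^ s) c m : ℤ) * a' m ^ (p ^ PureField.k p s a m - 1) ≡ 1
            [ZMOD (p : ℤ) ^ PureField.k p s a m]) →
        PureField.IsIntegralBasis
          (fun m : Fin (p ^ s) =>
            if (m : ℕ) < Nat.totient (p ^ s) then
              θ ^ (m : ℕ) / (PureField.C (p ^ s) c m : K)
            else
              (θ ^ (m : ℕ) + PureField.delta p s a c θ (a' m) (w m) m) /
                ((p : K) ^ PureField.k p s a m * (PureField.C (p ^ s) c m : K)))) := by
  have hn : p ^ s ≠ 0 := (pow_pos hp.pos s).ne'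
  have ha0 : a ≠ 0 := by
    rintro rfl
    rw [Int.natAbs_zero, eq_comm, Finset.prod_eq_zero_iff] at hc
    obtain ⟨j, hj, h0⟩ := hc
    exact (hc_sqf j hj).ne_zero ((pow_eq_zero_iff (by
      have := (Finset.mem_Icc.1 hj).1; omega)).1 h0)
  obtain ⟨B, ζ, σ, h⟩ := PureField.exists_isRadicalGenerator hn hirr hθ hK
  have hrepr : ∀ m i : Fin (p ^ s), B.repr (θ ^ (m : ℕ) / (PureField.C (p ^ s) c m : K)) i =
      if i = m then 1 / (PureField.C (p ^ s) c m : ℚ) else 0 := by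
    intro m i
    have h1 : θ ^ (m : ℕ) / (PureField.C (p ^ s) c m : K) =
        (1 / (PureField.C (p ^ s) c m : ℚ)) • θ ^ (m : ℕ) := by
      rw [Algebra.smul_def]
      simp only [map_div₀, map_one, map_natCast]; ring
    rw [h1, map_smul, Finsupp.smul_apply, h.repr_pow m.2, smul_eq_mul]
    simp [Fin.ext_iff, eq_comm]
  have hCint := PureField.isIntegral_pow_div_C hn hθ hc_sqf hc
  have hC0 := PureField.C_ne_zero (n := p ^ s) hc_sqf
  refine ⟨fun hr => ?_, fun hr a' w haw => ?_⟩
  · refine PureField.isIntegralBasis_of_triangular B _ (fun m => PureField.C (p ^ s) c m)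
      (fun m => hC0 m) (fun m => hCint m) (fun m => by rw [hrepr, if_pos rfl])
      (fun m i hmi => by rw [hrepr, if_neg hmi.ne']) fun β hβ m hm => ?_
    rcases hr with hr | hr
    · have hk : PureField.k p s a m = 0 := by
        have := (PureField.isLevelFunction_k (p := p) (s := s) (a := a) rfl).le m
        rw [PureField.d, hr] at this
        simpa using this
      have := h.exists_int_lead hp hs hirr hθ hK hc_sqf hc_cop hc hr.ge hβ m hm
      rwa [hk, pow_zero, one_mul] at this
    · have hdvd := PureField.dvd_of_r_eq_neg_one hp hs hirr hr
      refine h.exists_int_C_mul_repr hp hs ha0 (fun hJ => hpa ?_) hθ hc_sqf hc_cop hc hβ m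
      exact Int.dvd_gcd hdvd (by exact_mod_cast hJ)
  · have hr0 : 0 ≤ PureField.r p a := by omega
    -- k_m ≥ 1 requires m ≥ p^s - p^(s-1) = φ(p^s), so both branches fit the single denominator
    -- p^(k_m) C_m.
    have hlow : ∀ m : ℕ, m < Nat.totient (p ^ s) → PureField.k p s a m = 0 := by
      intro m hm
      by_contra hk
      have h1 := (PureField.isLevelFunction_k (p := p) (s := s) (a := a) rfl).sub_le m
      have h2 : p ^ (s - PureField.k p s a m) ≤ p ^ (s - 1) :=
        Nat.pow_le_pow_right hp.pos (by omega)
      rw [Nat.totient_prime_pow hp (by omega), Nat.mul_sub, mul_one, ← pow_succ,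
        Nat.sub_add_cancel hs] at hm
      omega
    refine PureField.isIntegralBasis_of_triangular B _
      (fun m => p ^ PureField.k p s a m * PureField.C (p ^ s) c m)
      (fun m => mul_ne_zero (pow_ne_zero _ hp.ne_zero) (hC0 m)) (fun m => ?_) (fun m => ?_)
      (fun m i hmi => ?_) fun β hβ m hm =>
        h.exists_int_lead hp hs hirr hθ hK hc_sqf hc_cop hc hr0 hβ m hm
    · split_ifs with hlt
      · exact hCint m
      · obtain ⟨h1, h2, h3⟩ := haw m (not_lt.1 hlt) m.2
        exact PureField.isIntegral_add_delta_div hp hθ hc_sqf hc hr0 h1 h2 h3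
    · split_ifs with hlt
      · rw [hrepr, if_pos rfl, hlow m hlt, pow_zero, one_mul]
      · rw [h.repr_add_delta_div hp hc_sqf hr0 _ _ le_rfl, if_pos rfl]
    · split_ifs with hlt
      · rw [hrepr, if_neg hmi.ne']
      · rw [h.repr_add_delta_div hp hc_sqf hr0 _ _ hmi.le, if_neg hmi.ne']
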